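/- Let $k$ be an algebraically closed field, let $S\subset k$ be a finite nonempty set with $0\notin S$, and let $n,r,D\ge 0$ be integers. Varieties are Zariski closed sets, not necessarily irreducible; the empty set has dimension $-1$. The degree of an irreducible variety is the number of points in which it meets a general linear subspace of complementary dimension, and the degree of a variety is the sum of the degrees of all its irreducible components (of every dimension). (Projective case) Let $V\subseteq\mathbb P^n$ be a projective variety of dimension $r$ and degree $D$. Let $\ell=c_0x_0+c_1x_1+\dots+c_{n-r}x_{n-r}$, where the coefficients $c_0,\dots,c_{n-r}$ are picked uniformly and independently from $S$, and let $H\subset\mathbb P^n$ be the hyperplane $\ell=0$. Then $\dim(V\cap H)=r-1$ with probability at least $1-D/|S|$. (Affine case) Let $V\subseteq\mathbb A^n$ be an affine variety of dimension $r$ and degree $D$. Let $m=\min(n,\,n-r+1)$ (so $m=n-r+1$ if $r\ge1$), let $\ell=c_0+c_1x_1+\dots+c_mx_m$, where the coefficients $c_0,\dots,c_m$ (including the constant term) are picked uniformly and independently from $S$, and let $H=\{x\in\mathbb A^n:\ell(x)=0\}$. Then $\dim(V\cap H)=r-1$ with probability at least $1-2D/|S|$. -/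

import Mathlib

open scoped LinearAlgebra.Projectivization

noncomputable section

/-- Affine space `𝔸ⁿ` over `k`, as a set of points. -/
def AffSpace (k : Type*) (n : ℕ) : Type _ := Fin n → k

/-- The coordinates `(x₁, …, xₙ)` of a point of `𝔸ⁿ`. -/
def AffSpace.coord {k : Type*} {n : ℕ} (x : AffSpace k n) : Fin n → k := x

/-- Projective space `ℙⁿ` over `k`, as the set of lines in `k ^ (n + 1)`. -/
def ProjSpace (k : Type*) [Field k] (n : ℕ) : Type _ := ℙ k (Fin (n + 1) → k)

/-- A choice of homogeneous coordinates `(x₀, …, xₙ)` of a point of `ℙⁿ`; below it is only used for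
the vanishing of homogeneous polynomials, which does not depend on the choice. -/
def ProjSpace.coord {k : Type*} [Field k] {n : ℕ} (p : ProjSpace k n) : Fin (n + 1) → k :=
  Projectivization.rep p

/-- The set of common zeros in `𝔸ⁿ` of a set of polynomials. -/
def affZeros {k : Type*} [Field k] {n : ℕ} (F : Set (MvPolynomial (Fin n) k)) :
    Set (AffSpace k n) :=
  {x | ∀ f ∈ F, MvPolynomial.eval x.coord f = 0}

/-- The set of common zeros in `ℙⁿ` of the homogeneous polynomials that belong to `F`. -/
def projZeros {k : Type*} [Field k] {n : ℕ} (F : Set (MvPolynomial (Fin (n + 1)) k)) :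
    Set (ProjSpace k n) :=
  {p | ∀ f ∈ F, (∃ d, f.IsHomogeneous d) → MvPolynomial.eval p.coord f = 0}

/-- The Zariski topology of `𝔸ⁿ`: the closed sets are the zero sets of sets of polynomials. -/
instance AffSpace.zariski (k : Type*) [Field k] (n : ℕ) : TopologicalSpace (AffSpace k n) :=
  TopologicalSpace.ofClosed (Set.range (affZeros (k := k) (n := n)))
    ⟨{1}, by ext x; simp [affZeros]⟩
    (by
      intro A hA
      refine ⟨{f | ∃ Z ∈ A, ∀ x ∈ Z, MvPolynomial.eval x.coord f = 0}, ?_⟩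
      ext x
      constructor
      · intro hx Z hZ
        obtain ⟨F, rfl⟩ := hA hZ
        exact fun f hf => hx f ⟨_, hZ, fun y hy => hy f hf⟩
      · rintro hx f ⟨Z, hZ, hf⟩
        exact hf x (hx Z hZ))
    (by
      rintro _ ⟨F, rfl⟩ _ ⟨G, rfl⟩
      refine ⟨{h | ∃ f ∈ F, ∃ g ∈ G, h = f * g}, ?_⟩
      ext x
      constructor
      · intro hx
        by_contra hc
        simp only [affZeros, Set.mem_union, Set.mem_ofPred_eq, not_or, not_forall] at hc
        obtain ⟨⟨f, hf, hfx⟩, ⟨g, hg, hgx⟩⟩ := hc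
        have := hx _ ⟨f, hf, g, hg, rfl⟩
        rw [map_mul] at this
        exact (mul_ne_zero hfx hgx) this
      · rintro (hx | hx) _ ⟨f, hf, g, hg, rfl⟩
        · rw [map_mul, hx f hf, zero_mul]
        · rw [map_mul, hx g hg, mul_zero])

/-- The Zariski topology of `ℙⁿ`: the closed sets are the zero sets of sets of homogeneous
polynomials. -/
instance ProjSpace.zariski (k : Type*) [Field k] (n : ℕ) : TopologicalSpace (ProjSpace k n) :=
  TopologicalSpace.ofClosed (Set.range (projZeros (k := k) (n := n)))
    ⟨{1}, by
      ext x
      simp only [projZeros, Set.mem_singleton_iff, forall_eq, map_one, one_ne_zero, imp_false,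
        Set.mem_ofPred_eq, Set.mem_empty_iff_false, iff_false, not_not]
      exact ⟨0, MvPolynomial.isHomogeneous_one _ _⟩⟩
    (by
      intro A hA
      refine ⟨{f | ∃ Z ∈ A, ∀ x ∈ Z, MvPolynomial.eval x.coord f = 0}, ?_⟩
      ext x
      constructor
      · intro hx Z hZ
        obtain ⟨F, rfl⟩ := hA hZ
        exact fun f hf hd => hx f ⟨_, hZ, fun y hy => hy f hf hd⟩ hd
      · rintro hx f ⟨Z, hZ, hf⟩ _
        exact hf x (hx Z hZ))
    (by
      rintro _ ⟨F, rfl⟩ _ ⟨G, rfl⟩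
      refine ⟨{h | ∃ f ∈ F, ∃ g ∈ G, (∃ d, f.IsHomogeneous d) ∧ (∃ e, g.IsHomogeneous e) ∧
        h = f * g}, ?_⟩
      ext x
      constructor
      · intro hx
        by_contra hc
        simp only [projZeros, Set.mem_union, Set.mem_ofPred_eq, not_or, not_forall] at hc
        obtain ⟨⟨f, hf, ⟨d, hd⟩, hfx⟩, ⟨g, hg, ⟨e, he⟩, hgx⟩⟩ := hc
        have := hx _ ⟨f, hf, g, hg, ⟨d, hd⟩, ⟨e, he⟩, rfl⟩ ⟨d + e, hd.mul he⟩
        rw [map_mul] at this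
        exact (mul_ne_zero hfx hgx) this
      · rintro (hx | hx) _ ⟨f, hf, g, hg, hd, he, rfl⟩ _
        · rw [map_mul, hx f hf hd, zero_mul]
        · rw [map_mul, hx g hg he, mul_zero])

/-- The dimension of a subset `V` of a topological space, as an integer `≥ -1` or `⊤`: the largest
length of a chain of irreducible closed subsets of `V`, where the empty set has dimension `-1`. -/
def zariskiDim {X : Type*} [TopologicalSpace X] (V : Set X) : WithTop ℤ :=
  WithBot.recBotCoe (-1) (fun e : ℕ∞ => ENat.map (fun m : ℕ => (m : ℤ)) e) (topologicalKrullDim V)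

/-- The irreducible components of a subset `V` of a topological space. -/
def componentsOf {X : Type*} [TopologicalSpace X] (V : Set X) : Set (Set X) :=
  {Z | Maximal (fun W => IsIrreducible W ∧ W ⊆ V) Z}

/-- The intersection of `ℙⁿ` with the linear subspace cut out by the `s` linear forms whose
coefficients are the rows of `A`. -/
def projLinear {k : Type*} [Field k] {n s : ℕ} (A : Fin s → Fin (n + 1) → k) :
    Set (ProjSpace k n) :=
  {p | ∀ i, ∑ j, A i j * p.coord j = 0}

/-- The affine subspace of `𝔸ⁿ` cut out by the `s` linear polynomials
`A i 0 + A i 1 * x₁ + ⋯ + A i n * xₙ`. -/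
def affLinear {k : Type*} [Field k] {n s : ℕ} (A : Fin s → Fin (n + 1) → k) :
    Set (AffSpace k n) :=
  {x | ∀ i, A i 0 + ∑ j : Fin n, A i j.succ * x.coord j = 0}

/-- A property of tuples of coefficients holds generically if it holds on a nonempty Zariski open
set of tuples, that is, wherever some fixed nonzero polynomial in the entries does not vanish. -/
def Generically {k : Type*} [Field k] {s m : ℕ} (Q : (Fin s → Fin m → k) → Prop) : Prop :=
  ∃ P : MvPolynomial (Fin s × Fin m) k, P ≠ 0 ∧
    ∀ A : Fin s → Fin m → k, MvPolynomial.eval (fun ij => A ij.1 ij.2) P ≠ 0 → Q A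

/-- The irreducible projective variety `Z` has degree `d`: a general linear subspace of
complementary dimension meets it in exactly `d` points. -/
def ProjIrredDegree {k : Type*} [Field k] {n : ℕ} (Z : Set (ProjSpace k n)) (d : ℕ) : Prop :=
  ∃ s : ℕ, zariskiDim Z = ((s : ℤ) : WithTop ℤ) ∧
    Generically fun A : Fin s → Fin (n + 1) → k => (Z ∩ projLinear A).encard = d

/-- The irreducible affine variety `Z` has degree `d`: a general affine linear subspace of
complementary dimension meets it in exactly `d` points. -/
def AffIrredDegree {k : Type*} [Field k] {n : ℕ} (Z : Set (AffSpace k n)) (d : ℕ) : Prop :=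
  ∃ s : ℕ, zariskiDim Z = ((s : ℤ) : WithTop ℤ) ∧
    Generically fun A : Fin s → Fin (n + 1) → k => (Z ∩ affLinear A).encard = d

/-- `D` is the sum of the degrees of all irreducible components of `V` (of every dimension), where
`irr Z d` says that the irreducible variety `Z` has degree `d`. -/
def IsDegreeSum {X : Type*} [TopologicalSpace X] (irr : Set X → ℕ → Prop) (V : Set X) (D : ℕ) :
    Prop :=
  ∃ (C : Finset (Set X)) (δ : Set X → ℕ),
    (C : Set (Set X)) = componentsOf V ∧ (∀ Z ∈ C, irr Z (δ Z)) ∧ D = ∑ Z ∈ C, δ Z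

/-- The projective variety `V` has degree `D`. -/
def ProjHasDegree {k : Type*} [Field k] {n : ℕ} (V : Set (ProjSpace k n)) (D : ℕ) : Prop :=
  IsDegreeSum ProjIrredDegree V D

/-- The affine variety `V` has degree `D`. -/
def AffHasDegree {k : Type*} [Field k] {n : ℕ} (V : Set (AffSpace k n)) (D : ℕ) : Prop :=
  IsDegreeSum AffIrredDegree V D

/-- The hyperplane `c₀ x₀ + ⋯ + c_{n-r} x_{n-r} = 0` in `ℙⁿ`. -/
def projHyperplane {k : Type*} [Field k] {n r : ℕ} (c : Fin (n - r + 1) → k) :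
    Set (ProjSpace k n) :=
  {p | ∑ j, c j * p.coord (Fin.castLE (by omega) j) = 0}

/-- The hyperplane `c₀ + c₁ x₁ + ⋯ + c_m x_m = 0` in `𝔸ⁿ`, where `m = n - r + 1` for `r ≥ 1`, and
`m = n` (all the variables) for `r = 0`. -/
def affHyperplane {k : Type*} [Field k] {n r : ℕ} (c : Fin (min n (n - r + 1) + 1) → k) :
    Set (AffSpace k n) :=
  {x | c 0 + ∑ j : Fin (min n (n - r + 1)), c j.succ * x.coord (Fin.castLE (by omega) j) = 0}

open Classical in
/-- The probability of the event `E` for a tuple of `m` coefficients that are picked uniformly and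
independently from the finite set `S`: the fraction of the tuples in `S ^ m` that belong to `E`. -/
def coeffProb {k : Type*} (S : Finset k) (m : ℕ) (E : (Fin m → k) → Prop) : ℝ :=
  (((Fintype.piFinset fun _ : Fin m => S).filter E).card : ℝ) / (S.card : ℝ) ^ m

end

/-! Let `H` be the random hyperplane. An irreducible closed subset of `V ∩ H` of dimension `r` would
have to be a component of `V`, so `dim (V ∩ H) < r` as soon as no component of dimension `r` lies in
`H`. For `r ≥ 1`, Krull's principal ideal theorem gives `dim (V ∩ H) ≥ r - 1`: always in the
projective case, because the vertex of the affine cone lies on every linear hyperplane, and in the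
affine case once `H` meets a component of dimension `r`. Every component has degree at least 1, so
the failure probabilities of the components can be added up and compared with `D / |S|` or `2 D /
|S|`.

Projective case: the cone over a component of dimension `r` has dimension `r + 1`, so the last `r`
coordinates cannot be the only nonconstant ones on it. Some point therefore has a nonzero coordinate
among the first `n - r + 1`, and the vanishing of the linear form there is a nontrivial linear
condition on the coefficients, of probability at most `1 / |S|`.

Affine case, `r ≥ 1`: likewise one of the first `m` coordinates separates two points `p`, `q` of the
component `Z`, of degree `d`. With probability at most `1 / |S|` the form takes equal values at `p`
and `q`; otherwise `Z` is not in `H`, and `H` misses `Z` only if the nonconstant function `∑ c_j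
x_j` omits the value `-c₀` on `Z`. It omits at most `d` values
(`AffIrredDegree.card_le_of_forall_ne`), so the total is at most `(1 + d) / |S| ≤ 2 d / |S|`.

The bound on omitted values is the main point. A generic linear projection makes `Z` finite over
affine space, with `d` points in a general fibre (`AffIrredDegree.exists_linMap`). Let `Q` be the
minimal polynomial of the function `f` over the polynomial ring of the base. Every root of a
specialization of `Q` is a value of `f` on the fibre, so `Q(a)` vanishes nowhere for an omitted
value `a` and is constant. Hence `a` is a root of the coefficient in `Q` of any nonconstant monomial
in the parameters. Up to inseparability this gives at most as many omitted values as a general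
specialization of `Q` has distinct roots, which is at most `d` (`exists_card_le_card_roots`). -/

/-! ### Chains of irreducible closed sets, components and dimension in a topological space. -/

section Topology

open TopologicalSpace

variable {X : Type*} [TopologicalSpace X]

/-- Since `V` is closed, chains in the subspace `V` and chains of irreducible closed subsets of `X`
inside `V` correspond by closure and preimage. This allows all later chains to live in the ambient
space. -/
theorem le_topologicalKrullDim_iff {V : Set X} (hV : IsClosed V) (s : ℕ) :
    (s : WithBot ℕ∞) ≤ topologicalKrullDim V ↔
      ∃ l : LTSeries (IrreducibleCloseds X), l.length = s ∧ (l.last : Set X) ⊆ V := by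
  rw [topologicalKrullDim, Order.le_krullDim_iff]
  constructor
  · rintro ⟨l, hl⟩
    refine ⟨l.map _ (IrreducibleCloseds.map_strictMono_of_isInducing
      Topology.IsInducing.subtypeVal), hl, ?_⟩
    rw [LTSeries.last_map]
    exact closure_minimal (by rintro _ ⟨x, -, rfl⟩; exact x.2) hV
  · rintro ⟨l, hl, hlast⟩
    have hsub (i) : (l i : Set X) ⊆ V :=
      (show (l i : Set X) ⊆ l.last from l.strictMono.monotone (Fin.le_last i)).trans hlast
    refine ⟨LTSeries.mk l.length (fun i => ⟨Subtype.val ⁻¹' (l i : Set X), ?_,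
      (l i).isClosed.preimage continuous_subtype_val⟩) ?_, hl⟩
    · have hne : (Subtype.val ⁻¹' (l i : Set X) : Set V).Nonempty := by
        obtain ⟨x, hx⟩ := (l i).isIrreducible.nonempty
        exact ⟨⟨x, hsub i hx⟩, hx⟩
      refine ⟨hne, ?_⟩
      rw [isPreirreducible_iff_isClosed_union_isClosed]
      intro z₁ z₂ h₁ h₂ h
      obtain ⟨t₁, ht₁, rfl⟩ := isClosed_induced_iff.mp h₁
      obtain ⟨t₂, ht₂, rfl⟩ := isClosed_induced_iff.mp h₂
      have := isPreirreducible_iff_isClosed_union_isClosed.mp (l i).isIrreducible.isPreirreducible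
        t₁ t₂ ht₁ ht₂ (fun x hx => h (show (⟨x, hsub i hx⟩ : V) ∈ _ from hx))
      exact this.imp (fun h x hx => h hx) (fun h x hx => h hx)
    · intro i j hij
      have hlt : l i < l j := l.strictMono hij
      refine lt_of_le_not_ge (fun x hx => hlt.le hx) (fun h => hlt.not_ge ?_)
      intro x hx
      exact h (show (⟨x, hsub j hx⟩ : V) ∈ _ from hx)

theorem topologicalKrullDim_mono {V W : Set X} (h : V ⊆ W) :
    topologicalKrullDim V ≤ topologicalKrullDim W :=
  (Topology.IsEmbedding.inclusion h).isInducing.topologicalKrullDim_le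

theorem exists_irreducible_of_le_topologicalKrullDim {V : Set X} (hV : IsClosed V) {s : ℕ}
    (h : (s : WithBot ℕ∞) ≤ topologicalKrullDim V) :
    ∃ Z : IrreducibleCloseds X, (Z : Set X) ⊆ V ∧
      (s : WithBot ℕ∞) ≤ topologicalKrullDim (Z : Set X) := by
  obtain ⟨l, hl, hlast⟩ := (le_topologicalKrullDim_iff hV s).mp h
  exact ⟨l.last, hlast, (le_topologicalKrullDim_iff l.last.isClosed s).mpr ⟨l, hl, le_rfl⟩⟩

theorem succ_le_topologicalKrullDim_of_lt {Z Y : IrreducibleCloseds X} (h : Z < Y) {s : ℕ}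
    (hs : (s : WithBot ℕ∞) ≤ topologicalKrullDim (Z : Set X)) :
    ((s + 1 : ℕ) : WithBot ℕ∞) ≤ topologicalKrullDim (Y : Set X) := by
  obtain ⟨l, hl, hlast⟩ := (le_topologicalKrullDim_iff Z.isClosed s).mp hs
  exact (le_topologicalKrullDim_iff Y.isClosed _).mpr
    ⟨RelSeries.snoc l Y (lt_of_le_of_lt hlast h), congrArg (· + 1) hl,
      (congrArg SetLike.coe (RelSeries.last_snoc l Y _)).le⟩

theorem zero_le_topologicalKrullDim_iff {V : Set X} :
    0 ≤ topologicalKrullDim V ↔ V.Nonempty := by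
  rw [topologicalKrullDim, Order.krullDim_nonneg_iff]
  constructor
  · rintro ⟨Z⟩
    obtain ⟨x, -⟩ := Z.isIrreducible.nonempty
    exact ⟨x, x.2⟩
  · rintro ⟨x, hx⟩
    exact ⟨⟨closure {⟨x, hx⟩}, isIrreducible_singleton.closure, isClosed_closure⟩⟩

theorem zariskiDim_eq_natCast_iff {V : Set X} {r : ℕ} :
    zariskiDim V = ((r : ℤ) : WithTop ℤ) ↔ topologicalKrullDim V = (r : WithBot ℕ∞) := by
  unfold zariskiDim
  generalize topologicalKrullDim V = d
  induction d using WithBot.recBotCoe with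
  | bot =>
    have h1 : ((-1 : ℤ) : WithTop ℤ) ≠ ((r : ℤ) : WithTop ℤ) := by
      intro h; have := WithTop.coe_injective h; omega
    exact iff_of_false h1 (by simp)
  | coe e =>
    induction e using ENat.recTopCoe with
    | top => exact iff_of_false (WithTop.top_ne_coe) (by intro h; simpa using WithBot.coe_injective h)
    | coe m =>
      change ((m : ℤ) : WithTop ℤ) = _ ↔ ((m : ℕ∞) : WithBot ℕ∞) = _
      constructor
      · intro h
        have := WithTop.coe_injective h
        norm_cast at this
        rw [this]; rfl
      · intro h
        have : m = r := by exact_mod_cast h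
        rw [this]

theorem zariskiDim_empty_eq : zariskiDim (∅ : Set X) = ((-1 : ℤ) : WithTop ℤ) := by
  have : topologicalKrullDim (∅ : Set X) = ⊥ := by
    rw [topologicalKrullDim, Order.krullDim_eq_bot_iff]
    exact ⟨fun Z => by obtain ⟨x, -⟩ := Z.isIrreducible.nonempty; exact x.2⟩
  unfold zariskiDim
  rw [this]
  rfl

/-- For `r = 0` the lower bound is vacuous and `W` is empty, of dimension `-1`; this is why `hlb` is
stated with a successor. -/
theorem zariskiDim_eq_sub_one {W : Set X} {r : ℕ}
    (hub : ¬ (r : WithBot ℕ∞) ≤ topologicalKrullDim W)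
    (hlb : ∀ s : ℕ, r = s + 1 → (s : WithBot ℕ∞) ≤ topologicalKrullDim W) :
    zariskiDim W = (((r : ℤ) - 1 : ℤ) : WithTop ℤ) := by
  cases r with
  | zero =>
    have : W = ∅ := by
      rw [← Set.not_nonempty_iff_eq_empty, ← zero_le_topologicalKrullDim_iff]
      exact_mod_cast hub
    subst this
    simpa using zariskiDim_empty_eq (X := X)
  | succ s =>
    have h1 := hlb s rfl
    have : (((s + 1 : ℕ) : ℤ) - 1 : ℤ) = (s : ℤ) := by push_cast; ring
    rw [this, zariskiDim_eq_natCast_iff]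
    refine le_antisymm ?_ h1
    rw [not_le] at hub
    generalize topologicalKrullDim W = d at *
    induction d using WithBot.recBotCoe with
    | bot => simp
    | coe e =>
      induction e using ENat.recTopCoe with
      | top => exact absurd hub (by simp)
      | coe m =>
        norm_cast at hub ⊢
        omega

theorem exists_mem_componentsOf {V : Set X} {Z : Set X} (hZ : IsIrreducible Z)
    (hZV : Z ⊆ V) : ∃ Y ∈ componentsOf V, Z ⊆ Y := by
  obtain ⟨Y, hY, hm⟩ := zorn_subset_nonempty {W : Set X | IsIrreducible W ∧ W ⊆ V}
    (fun c hc hchain hne => by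
      refine ⟨⋃₀ c, ⟨⟨?_, ?_⟩, Set.sUnion_subset fun W hW => (hc hW).2⟩,
        fun W hW => Set.subset_sUnion_of_mem hW⟩
      · obtain ⟨W, hW⟩ := hne
        exact (hc hW).1.nonempty.mono (Set.subset_sUnion_of_mem hW)
      · rintro u v hu hv ⟨x, ⟨A, hA, hxA⟩, hxu⟩ ⟨y, ⟨B, hB, hyB⟩, hyv⟩
        rcases hchain.total hA hB with h | h
        · obtain ⟨z, hz, h'⟩ := (hc hB).1.isPreirreducible u v hu hv ⟨x, h hxA, hxu⟩ ⟨y, hyB, hyv⟩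
          exact ⟨z, ⟨B, hB, hz⟩, h'⟩
        · obtain ⟨z, hz, h'⟩ := (hc hA).1.isPreirreducible u v hu hv ⟨x, hxA, hxu⟩ ⟨y, h hyB, hyv⟩
          exact ⟨z, ⟨A, hA, hz⟩, h'⟩)
    Z ⟨hZ, hZV⟩
  exact ⟨Y, hm, hY⟩

theorem isClosed_of_mem_componentsOf {V Z : Set X} (hV : IsClosed V) (hZ : Z ∈ componentsOf V) :
    IsClosed Z := by
  have h : closure Z ≤ Z :=
    hZ.2 ⟨hZ.1.1.closure, closure_minimal hZ.1.2 hV⟩ subset_closure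
  exact isClosed_of_closure_subset h

/-- An irreducible closed set of dimension at least `r` in `V ∩ H` lies in a component of dimension
`r` that is not inside `H`. The inclusion is then strict and raises the dimension beyond `r`. -/
theorem not_le_topologicalKrullDim_inter {V H : Set X} (hV : IsClosed V) (hH : IsClosed H) {r : ℕ}
    (hr : topologicalKrullDim V = (r : WithBot ℕ∞))
    (h : ∀ Z ∈ componentsOf V, topologicalKrullDim Z = (r : WithBot ℕ∞) → ¬ Z ⊆ H) :
    ¬ (r : WithBot ℕ∞) ≤ topologicalKrullDim (V ∩ H : Set X) := by
  intro hle
  obtain ⟨Z, hZ, hZr⟩ := exists_irreducible_of_le_topologicalKrullDim (hV.inter hH) hle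
  obtain ⟨Y, hY, hZY⟩ := exists_mem_componentsOf Z.isIrreducible (hZ.trans Set.inter_subset_left)
  have hYr : topologicalKrullDim Y = (r : WithBot ℕ∞) :=
    le_antisymm (hr ▸ topologicalKrullDim_mono hY.1.2)
      (hZr.trans (topologicalKrullDim_mono hZY))
  have hYH := h Y hY hYr
  let Y' : IrreducibleCloseds X := ⟨Y, hY.1.1, isClosed_of_mem_componentsOf hV hY⟩
  have hlt : Z < Y' := lt_of_le_not_ge hZY
    fun h' => hYH ((show Y ⊆ Z from h').trans (hZ.trans Set.inter_subset_right))
  have := succ_le_topologicalKrullDim_of_lt hlt hZr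
  rw [show topologicalKrullDim (Y' : Set X) = (r : WithBot ℕ∞) from hYr] at this
  norm_cast at this
  omega

theorem exists_mem_componentsOf_topologicalKrullDim_eq {V : Set X} (hV : IsClosed V) {r : ℕ}
    (hr : topologicalKrullDim V = (r : WithBot ℕ∞)) :
    ∃ Z ∈ componentsOf V, topologicalKrullDim Z = (r : WithBot ℕ∞) := by
  obtain ⟨Z, hZ, hZr⟩ := exists_irreducible_of_le_topologicalKrullDim hV hr.ge
  obtain ⟨Y, hY, hZY⟩ := exists_mem_componentsOf Z.isIrreducible hZ
  exact ⟨Y, hY, le_antisymm (hr ▸ topologicalKrullDim_mono hY.1.2)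
      (hZr.trans (topologicalKrullDim_mono hZY))⟩

end Topology

/-! ### Krull dimension, transcendence degree and heights for finitely generated domains. -/

section DimensionTheory

open TopologicalSpace

/-- By the Nullstellensatz a translation carries any maximal ideal to the one at the origin, so all
have the same height, and the supremum of the heights is the Krull dimension `s`. -/
theorem MvPolynomial.height_eq_of_isMaximal {k : Type*} [Field k] [IsAlgClosed k] {s : ℕ}
    (m : Ideal (MvPolynomial (Fin s) k)) [hm : m.IsMaximal] : m.height = s := by
  have key : ∀ m : Ideal (MvPolynomial (Fin s) k), m.IsMaximal →
      m.height = (RingHom.ker (MvPolynomial.aeval (R := k) (0 : Fin s → k))).height := by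
    intro m hm
    obtain ⟨x, rfl⟩ := MvPolynomial.isMaximal_iff_eq_vanishingIdeal_singleton.mp hm
    let f : MvPolynomial (Fin s) k →ₐ[k] MvPolynomial (Fin s) k :=
      MvPolynomial.aeval fun i => MvPolynomial.X i + MvPolynomial.C (x i)
    let g : MvPolynomial (Fin s) k →ₐ[k] MvPolynomial (Fin s) k :=
      MvPolynomial.aeval fun i => MvPolynomial.X i - MvPolynomial.C (x i)
    let e : MvPolynomial (Fin s) k ≃ₐ[k] MvPolynomial (Fin s) k :=
      AlgEquiv.ofAlgHom f g (by ext i; simp [f, g]) (by ext i; simp [f, g])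
    rw [← RingEquiv.height_comap e.toRingEquiv (RingHom.ker (MvPolynomial.aeval (R := k) 0))]
    congr 1
    ext p
    rw [MvPolynomial.mem_vanishingIdeal_singleton_iff, Ideal.mem_comap, RingHom.mem_ker]
    change _ ↔ MvPolynomial.aeval (0 : Fin s → k) (f p) = 0
    have : (MvPolynomial.aeval (R := k) (0 : Fin s → k)).comp f = MvPolynomial.aeval x := by
      ext i; simp [f]
    rw [← AlgHom.comp_apply, this]
  have h1 := Ideal.sup_isMaximal_height_eq_ringKrullDim (R := MvPolynomial (Fin s) k)
  rw [MvPolynomial.ringKrullDim_of_isNoetherianRing, ringKrullDim_eq_zero_of_field] at h1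
  simp only [Nat.card_eq_fintype_card, Fintype.card_fin, zero_add] at h1
  have h2 : (⨆ (I : Ideal (MvPolynomial (Fin s) k)) (_ : I.IsMaximal), I.height) = m.height := by
    refine le_antisymm (iSup₂_le fun I hI => ?_) (le_iSup₂_of_le m hm le_rfl)
    rw [key I hI, key m hm]
  rw [h2] at h1
  exact_mod_cast h1

section

variable {k R : Type*} [Field k] [CommRing R] [IsDomain R] [Algebra k R]

/-- Going down holds for integral extensions of the normal domain `k[T₁, …, T_s]`, so a chain of
length `s` below the contraction of `m` lifts to a chain below `m`. -/
theorem natCast_le_height_of_isMaximal_of_isIntegral [IsAlgClosed k] {s : ℕ}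
    (φ : MvPolynomial (Fin s) k →ₐ[k] R) (hφ : Function.Injective φ)
    (hint : φ.toRingHom.IsIntegral) (m : Ideal R) [hm : m.IsMaximal] : (s : ℕ∞) ≤ m.height := by
  algebraize [φ.toRingHom]
  have : FaithfulSMul (MvPolynomial (Fin s) k) R := (faithfulSMul_iff_algebraMap_injective _ _).mpr hφ
  let n := m.under (MvPolynomial (Fin s) k)
  have hn : n.IsMaximal := Ideal.isMaximal_comap_of_isIntegral_of_isMaximal m
  have hh := MvPolynomial.height_eq_of_isMaximal n
  have : n.FiniteHeight := ⟨Or.inr (by rw [hh]; exact ENat.natCast_ne_top _)⟩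
  obtain ⟨l, hl, hlen⟩ := n.exists_ltSeries_length_eq_height
  have : m.LiesOver l.last.asIdeal := by rw [hl]; exact ⟨rfl⟩
  obtain ⟨L, hL, hlast, -⟩ := Ideal.exists_ltSeries_of_hasGoingDown l m
  have : (L.length : ℕ∞) ≤ Order.height L.last := Order.length_le_height_last
  rw [hL, hlen, hh, hlast, ← PrimeSpectrum.height_eq_orderHeight] at this
  exact this

theorem ringKrullDim_le_of_isIntegral {A B : Type*} [CommRing A] [CommRing B] [Algebra A B]
    [Algebra.IsIntegral A B] : ringKrullDim B ≤ ringKrullDim A :=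
  Order.krullDim_le_of_strictMono (PrimeSpectrum.comap (algebraMap A B)) fun _ _ h =>
    Ideal.IsIntegral.comap_lt_comap (R := A) h

/-- The Krull dimension of a finitely generated domain over an algebraically closed field is its
transcendence degree and the height of each of its maximal ideals. -/
theorem exists_ringKrullDim_eq_trdeg_eq_height [IsAlgClosed k] [Algebra.FiniteType k R] :
    ∃ s : ℕ, ringKrullDim R = s ∧ Algebra.trdeg k R = s ∧
      ∀ m : Ideal R, m.IsMaximal → m.height = s := by
  -- Noether normalization: going down bounds all heights below by `s`, incomparability bounds the
  -- dimension above by `s`.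
  obtain ⟨s, φ, hφ, hint⟩ := exists_integral_inj_algHom_of_fg k R
  have hle : ∀ m : Ideal R, m.IsMaximal → (s : ℕ∞) ≤ m.height := fun m hm =>
    natCast_le_height_of_isMaximal_of_isIntegral φ hφ hint m
  have hdim : ringKrullDim R ≤ s := by
    algebraize [φ.toRingHom]
    refine (ringKrullDim_le_of_isIntegral (A := MvPolynomial (Fin s) k)).trans ?_
    rw [MvPolynomial.ringKrullDim_of_isNoetherianRing, ringKrullDim_eq_zero_of_field]
    simp
  have hge : ∀ m : Ideal R, m.IsMaximal → m.height = s := by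
    intro m hm
    refine le_antisymm ?_ (hle m hm)
    have := (Ideal.height_le_ringKrullDim_of_ne_top hm.ne_top).trans hdim
    exact_mod_cast this
  refine ⟨s, ?_, ?_, hge⟩
  · obtain ⟨m, hm⟩ := Ideal.exists_maximal R
    refine le_antisymm hdim ?_
    have := Ideal.height_le_ringKrullDim_of_ne_top hm.ne_top
    rw [hge m hm] at this
    exact_mod_cast this
  · algebraize [φ.toRingHom]
    have : IsScalarTower k (MvPolynomial (Fin s) k) R := .of_algHom φ
    have hf : FaithfulSMul (MvPolynomial (Fin s) k) R :=
      (faithfulSMul_iff_algebraMap_injective _ _).mpr hφ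
    have h1 := lift_trdeg_add_eq k (MvPolynomial (Fin s) k) R
    rw [trdeg_eq_zero (R := MvPolynomial (Fin s) k) (A := R), MvPolynomial.trdeg_of_isDomain] at h1
    simpa using h1.symm

end

end DimensionTheory

/-! ### The dictionary between closed sets of affine space and ideals; Krull's principal ideal
theorem. -/

section AffineGeometry

open TopologicalSpace

variable {k : Type*} [Field k] {n : ℕ}

/-- The ideal of polynomials that vanish on a subset of `𝔸ⁿ`. -/
def affIdeal (V : Set (AffSpace k n)) : Ideal (MvPolynomial (Fin n) k) :=
  MvPolynomial.vanishingIdeal k (show Set (Fin n → k) from V)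

theorem mem_affIdeal {V : Set (AffSpace k n)} {f : MvPolynomial (Fin n) k} :
    f ∈ affIdeal V ↔ ∀ x ∈ V, MvPolynomial.eval x.coord f = 0 := Iff.rfl

theorem affIdeal_anti {V W : Set (AffSpace k n)} (h : V ⊆ W) : affIdeal W ≤ affIdeal V :=
  fun _ hf x hx => hf x (h hx)

theorem AffSpace.isClosed_iff {V : Set (AffSpace k n)} : IsClosed V ↔ ∃ F, affZeros F = V := by
  rw [← isOpen_compl_iff]
  change Vᶜᶜ ∈ Set.range affZeros ↔ _
  rw [compl_compl, Set.mem_range]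

theorem isClosed_affZeros (F : Set (MvPolynomial (Fin n) k)) : IsClosed (affZeros F) :=
  AffSpace.isClosed_iff.mpr ⟨F, rfl⟩

theorem subset_affZeros_iff {V : Set (AffSpace k n)} {F : Set (MvPolynomial (Fin n) k)} :
    V ⊆ affZeros F ↔ F ⊆ affIdeal V :=
  ⟨fun h _ hf _ hx => h hx _ hf, fun h _ hx _ hf => h hf _ hx⟩

theorem affZeros_affIdeal {V : Set (AffSpace k n)} (hV : IsClosed V) :
    affZeros (affIdeal V : Set (MvPolynomial (Fin n) k)) = V := by
  obtain ⟨F, rfl⟩ := AffSpace.isClosed_iff.mp hV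
  exact subset_antisymm (fun x hx f hf => hx f fun y hy => hy f hf) fun x hx f hf => hf x hx

theorem subset_of_affIdeal_le {V W : Set (AffSpace k n)} (hV : IsClosed V)
    (h : affIdeal V ≤ affIdeal W) : W ⊆ V := by
  rw [← affZeros_affIdeal hV]
  exact subset_affZeros_iff.mpr h

theorem affIdeal_isPrime {Z : Set (AffSpace k n)} (hZ : IsIrreducible Z) :
    (affIdeal Z).IsPrime := by
  constructor
  · obtain ⟨x, hx⟩ := hZ.nonempty
    rw [Ideal.ne_top_iff_one]
    intro h
    have := mem_affIdeal.mp h x hx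
    simp at this
  · intro f g hfg
    have := isPreirreducible_iff_isClosed_union_isClosed.mp hZ.isPreirreducible
      (affZeros {f}) (affZeros {g}) (isClosed_affZeros _) (isClosed_affZeros _) ?_
    · simpa [subset_affZeros_iff] using this
    · intro x hx
      have := mem_affIdeal.mp hfg x hx
      rw [map_mul, mul_eq_zero] at this
      simpa [affZeros] using this

theorem isIrreducible_of_affIdeal_isPrime {Z : Set (AffSpace k n)} (hZ : (affIdeal Z).IsPrime) :
    IsIrreducible Z := by
  constructor
  · rw [Set.nonempty_iff_ne_empty]
    rintro rfl
    exact hZ.ne_top (Ideal.eq_top_iff_one _ |>.mpr fun x hx => absurd hx (Set.notMem_empty x))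
  · rw [isPreirreducible_iff_isClosed_union_isClosed]
    intro z₁ z₂ h₁ h₂ h
    by_contra! hc
    obtain ⟨x, hx, hx₁⟩ := Set.not_subset.mp hc.1
    obtain ⟨y, hy, hy₂⟩ := Set.not_subset.mp hc.2
    rw [← affZeros_affIdeal h₁] at hx₁
    rw [← affZeros_affIdeal h₂] at hy₂
    simp only [affZeros, Set.mem_ofPred_eq, not_forall] at hx₁ hy₂
    obtain ⟨f, hf, hfx⟩ := hx₁
    obtain ⟨g, hg, hgy⟩ := hy₂
    have hfg : f * g ∈ affIdeal Z := by
      rw [mem_affIdeal]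
      intro z hz
      rw [map_mul]
      rcases h hz with h' | h'
      · rw [mem_affIdeal.mp hf z h', zero_mul]
      · rw [mem_affIdeal.mp hg z h', mul_zero]
    rcases hZ.mem_or_mem hfg with h' | h'
    · exact hfx (h' x hx)
    · exact hgy (h' y hy)

theorem affIdeal_affZeros [IsAlgClosed k] (p : Ideal (MvPolynomial (Fin n) k)) [p.IsPrime] :
    affIdeal (affZeros (p : Set (MvPolynomial (Fin n) k))) = p :=
  MvPolynomial.IsPrime.vanishingIdeal_zeroLocus p

/-- The irreducible closed set cut out by a prime ideal. -/
def primeZeros [IsAlgClosed k] (p : Ideal (MvPolynomial (Fin n) k)) [hp : p.IsPrime] :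
    IrreducibleCloseds (AffSpace k n) where
  carrier := affZeros (p : Set (MvPolynomial (Fin n) k))
  isIrreducible' := isIrreducible_of_affIdeal_isPrime (by rwa [affIdeal_affZeros])
  isClosed' := isClosed_affZeros _

theorem topologicalKrullDim_le_ringKrullDim {V : Set (AffSpace k n)} (hV : IsClosed V) :
    topologicalKrullDim V ≤ ringKrullDim (MvPolynomial (Fin n) k ⧸ affIdeal V) := by
  rw [ringKrullDim_quotient, ← Order.krullDim_orderDual, topologicalKrullDim]
  refine Order.krullDim_le_of_strictMono (fun Z => OrderDual.toDual
    ⟨⟨affIdeal (Subtype.val '' (Z : Set V)),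
      affIdeal_isPrime (Z.isIrreducible.image _ continuous_subtype_val.continuousOn)⟩,
      affIdeal_anti (by rintro _ ⟨x, -, rfl⟩; exact x.2)⟩) ?_
  intro Z Z' h
  have hcl : IsClosed (Subtype.val '' (Z : Set V)) := hV.isClosedMap_subtype_val _ Z.isClosed
  refine lt_of_le_not_ge (affIdeal_anti (Set.image_mono h.le)) fun h' => h.not_ge ?_
  have := subset_of_affIdeal_le hcl h'
  exact (Set.image_subset_image_iff Subtype.val_injective).mp this

/-- Primes of `T` pull back to primes containing the kernel, and these are recovered from their zero
sets. `T` may be nonreduced, as is needed for the quotient of a coordinate ring by one function. -/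
theorem le_topologicalKrullDim_affZeros_ker [IsAlgClosed k] {T : Type*} [CommRing T]
    (φ : MvPolynomial (Fin n) k →+* T) (hφ : Function.Surjective φ) {s : ℕ}
    (hs : (s : WithBot ℕ∞) ≤ ringKrullDim T) :
    (s : WithBot ℕ∞) ≤ topologicalKrullDim (affZeros (RingHom.ker φ : Set (MvPolynomial (Fin n) k))) := by
  rw [le_topologicalKrullDim_iff (isClosed_affZeros _)]
  have h1 : ringKrullDim T ≤ Order.krullDim
      {Z : IrreducibleCloseds (AffSpace k n) // (Z : Set _) ⊆ affZeros (RingHom.ker φ : Set (MvPolynomial (Fin n) k))} := by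
    rw [ringKrullDim, ← Order.krullDim_orderDual]
    refine Order.krullDim_le_of_strictMono (fun P =>
      ⟨primeZeros ((OrderDual.ofDual P).asIdeal.comap φ), fun x hx _ hf => hx _ ?_⟩) ?_
    · change φ _ ∈ (OrderDual.ofDual P).asIdeal
      rw [RingHom.mem_ker.mp hf]
      exact zero_mem _
    · intro P Q h
      have h' : (OrderDual.ofDual Q).asIdeal < (OrderDual.ofDual P).asIdeal := h
      have h2 : (OrderDual.ofDual Q).asIdeal.comap φ < (OrderDual.ofDual P).asIdeal.comap φ :=
        lt_of_le_not_ge (Ideal.comap_mono h'.le) fun h3 =>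
          h'.not_ge ((Ideal.comap_le_comap_iff_of_surjective φ hφ _ _).mp h3)
      refine lt_of_le_not_ge (fun x hx _ hf => hx _ (h2.le hf)) fun h3 => h2.not_ge ?_
      have := affIdeal_anti (k := k) h3
      change affIdeal (affZeros _) ≤ affIdeal (affZeros _) at this
      rwa [affIdeal_affZeros, affIdeal_affZeros] at this
  obtain ⟨l, hl⟩ := Order.le_krullDim_iff.mp (hs.trans h1)
  exact ⟨l.map Subtype.val fun _ _ h => h, hl, l.last.2⟩

/-- The coordinate ring of a subset of `𝔸ⁿ`. -/
abbrev coordRing (Z : Set (AffSpace k n)) : Type _ := MvPolynomial (Fin n) k ⧸ affIdeal Z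

/-- The evaluation of functions on `Z` at a point of `Z`. -/
noncomputable def evalPoint {Z : Set (AffSpace k n)} {x : AffSpace k n} (hx : x ∈ Z) : coordRing Z →ₐ[k] k :=
  Ideal.Quotient.liftₐ (affIdeal Z) (MvPolynomial.aeval x.coord) fun _ hf => mem_affIdeal.mp hf x hx

theorem evalPoint_mk {Z : Set (AffSpace k n)} {x : AffSpace k n} (hx : x ∈ Z)
    (f : MvPolynomial (Fin n) k) :
    evalPoint hx (Ideal.Quotient.mk _ f) = MvPolynomial.eval x.coord f := rfl

variable [IsAlgClosed k]

theorem exists_topologicalKrullDim_eq_trdeg_eq_height {Z : Set (AffSpace k n)} (hZ : IsClosed Z)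
    (hirr : IsIrreducible Z) :
    ∃ s : ℕ, topologicalKrullDim Z = s ∧ Algebra.trdeg k (coordRing Z) = s ∧
      ∀ m : Ideal (coordRing Z), m.IsMaximal → m.height = s := by
  have := affIdeal_isPrime hirr
  obtain ⟨s, h1, h2, h3⟩ := exists_ringKrullDim_eq_trdeg_eq_height (k := k) (R := coordRing Z)
  refine ⟨s, le_antisymm (h1 ▸ topologicalKrullDim_le_ringKrullDim hZ) ?_, h2, h3⟩
  have := le_topologicalKrullDim_affZeros_ker (Ideal.Quotient.mk (affIdeal Z))
    Ideal.Quotient.mk_surjective h1.ge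
  rwa [Ideal.mk_ker, affZeros_affIdeal hZ] at this

theorem trdeg_coordRing_eq {Z : Set (AffSpace k n)} (hZ : IsClosed Z) (hirr : IsIrreducible Z)
    {s : ℕ} (hs : topologicalKrullDim Z = s) : Algebra.trdeg k (coordRing Z) = s := by
  obtain ⟨s', h1, h2, -⟩ := exists_topologicalKrullDim_eq_trdeg_eq_height hZ hirr
  rw [hs] at h1
  have : s = s' := by exact_mod_cast h1
  rw [this, h2]

theorem natCast_le_of_succ_le_add_one {d : WithBot ℕ∞} {s : ℕ}
    (h : ((s + 1 : ℕ) : WithBot ℕ∞) ≤ d + 1) : (s : WithBot ℕ∞) ≤ d := by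
  induction d using WithBot.recBotCoe with
  | bot => exact absurd h (by simp)
  | coe e =>
    induction e using ENat.recTopCoe with
    | top => exact WithBot.coe_le_coe.mpr le_top
    | coe m =>
      norm_cast at h ⊢
      omega

/-- The maximal ideal at `x` has height `dim Z` and contains `f`, so dividing by `f` lowers the
dimension by at most one. The point `x` guarantees that the intersection is nonempty. -/
theorem le_topologicalKrullDim_inter_affZeros {Z : Set (AffSpace k n)} (hZ : IsClosed Z)
    (hirr : IsIrreducible Z) {x : AffSpace k n} (hx : x ∈ Z) {f : MvPolynomial (Fin n) k}
    (hf : MvPolynomial.eval x.coord f = 0) {s : ℕ}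
    (hs : ((s + 1 : ℕ) : WithBot ℕ∞) ≤ topologicalKrullDim Z) :
    (s : WithBot ℕ∞) ≤ topologicalKrullDim (Z ∩ affZeros {f} : Set (AffSpace k n)) := by
  obtain ⟨t, ht, -, hh⟩ := exists_topologicalKrullDim_eq_trdeg_eq_height hZ hirr
  have := affIdeal_isPrime hirr
  let m : Ideal (coordRing Z) := RingHom.ker (evalPoint hx)
  have hm : m.IsMaximal := RingHom.ker_isMaximal_of_surjective _
    fun a => ⟨algebraMap k _ a, (evalPoint hx).commutes a⟩
  have hmem : Ideal.Quotient.mk (affIdeal Z) f ∈ m := hf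
  have h1 := Ideal.height_le_ringKrullDim_quotient_add_one hmem
  rw [hh m hm] at h1
  rw [ht] at hs
  have h2 := natCast_le_of_succ_le_add_one (hs.trans h1)
  let φ := (Ideal.Quotient.mk (Ideal.span {Ideal.Quotient.mk (affIdeal Z) f})).comp
    (Ideal.Quotient.mk (affIdeal Z))
  have hφ : Function.Surjective φ :=
    Ideal.Quotient.mk_surjective.comp Ideal.Quotient.mk_surjective
  refine (le_topologicalKrullDim_affZeros_ker φ hφ h2).trans (topologicalKrullDim_mono ?_)
  refine Set.subset_inter ?_ ?_
  · refine subset_trans (b := affZeros (affIdeal Z : Set (MvPolynomial (Fin n) k))) (fun x hx g hg => ?_)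
      (affZeros_affIdeal hZ).subset
    refine hx g ?_
    change φ g = 0
    rw [RingHom.comp_apply, Ideal.Quotient.eq_zero_iff_mem.mpr hg, map_zero]
  · intro x hx g hg
    rw [Set.mem_singleton_iff.mp hg]
    refine hx f (Ideal.Quotient.eq_zero_iff_mem.mpr (Ideal.mem_span_singleton_self _))

end AffineGeometry

/-! ### Projective varieties through their affine cones. -/

section ProjectiveGeometry

open TopologicalSpace

attribute [local instance] MvPolynomial.gradedAlgebra

variable {k : Type*} [Field k] {n : ℕ}

theorem MvPolynomial.IsHomogeneous.eval_smul {σ : Type*} {f : MvPolynomial σ k} {d : ℕ}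
    (hf : f.IsHomogeneous d) (a : k) (x : σ → k) :
    MvPolynomial.eval (a • x) f = a ^ d * MvPolynomial.eval x f := by
  rw [MvPolynomial.eval_eq, MvPolynomial.eval_eq, Finset.mul_sum]
  refine Finset.sum_congr rfl fun m hm => ?_
  have hd : m.degree = d := by
    by_contra h
    exact MvPolynomial.mem_support_iff.mp hm (hf.coeff_eq_zero h)
  have : ∏ i ∈ m.support, (a • x) i ^ m i = a ^ d * ∏ i ∈ m.support, x i ^ m i := by
    simp only [Pi.smul_apply, smul_eq_mul, mul_pow, Finset.prod_mul_distrib]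
    rw [Finset.prod_pow_eq_pow_sum, ← hd]
    rfl
  rw [this]
  ring

theorem ProjSpace.isClosed_iff {V : Set (ProjSpace k n)} : IsClosed V ↔ ∃ F, projZeros F = V := by
  rw [← isOpen_compl_iff]
  change Vᶜᶜ ∈ Set.range projZeros ↔ _
  rw [compl_compl, Set.mem_range]

theorem isClosed_projZeros (F : Set (MvPolynomial (Fin (n + 1)) k)) : IsClosed (projZeros F) :=
  ProjSpace.isClosed_iff.mpr ⟨F, rfl⟩

/-- The point of `ℙⁿ` with given homogeneous coordinates. -/
def projPoint (x : Fin (n + 1) → k) (hx : x ≠ 0) : ProjSpace k n := Projectivization.mk k x hx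

theorem ProjSpace.coord_ne_zero (p : ProjSpace k n) : p.coord ≠ 0 := Projectivization.rep_nonzero p

theorem projPoint_coord (p : ProjSpace k n) : projPoint p.coord p.coord_ne_zero = p :=
  Projectivization.mk_rep p

theorem exists_smul_eq_coord_projPoint (x : Fin (n + 1) → k) (hx : x ≠ 0) :
    ∃ a : k, a ≠ 0 ∧ (projPoint x hx).coord = a • x := by
  obtain ⟨a, ha⟩ := Projectivization.exists_smul_eq_mk_rep k x hx
  exact ⟨a, a.ne_zero, ha.symm⟩

theorem projPoint_smul (x : Fin (n + 1) → k) (hx : x ≠ 0) (a : k) (ha : a • x ≠ 0) :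
    projPoint (a • x) ha = projPoint x hx :=
  (Projectivization.mk_eq_mk_iff' k _ _ ha hx).mpr ⟨a, rfl⟩

theorem eval_coord_projPoint_eq_zero_iff {f : MvPolynomial (Fin (n + 1)) k} {d : ℕ}
    (hf : f.IsHomogeneous d) (x : Fin (n + 1) → k) (hx : x ≠ 0) :
    MvPolynomial.eval (projPoint x hx).coord f = 0 ↔ MvPolynomial.eval x f = 0 := by
  obtain ⟨a, ha, h⟩ := exists_smul_eq_coord_projPoint x hx
  rw [h, hf.eval_smul]
  simp [ha]

/-- The affine cone over a subset of `ℙⁿ`, including its vertex. -/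
def cone (W : Set (ProjSpace k n)) : Set (AffSpace k (n + 1)) :=
  {x | ∀ hx : x.coord ≠ 0, projPoint x.coord hx ∈ W}

/-- A set that is stable under scaling. -/
def IsConical (Y : Set (AffSpace k n)) : Prop :=
  ∀ x ∈ Y, ∀ a : k, (a • x.coord : Fin n → k) ∈ Y

theorem isConical_cone (W : Set (ProjSpace k n)) : IsConical (cone W) := by
  intro x hx a ha
  have hx0 : x.coord ≠ 0 := by
    intro h
    exact ha (show a • x.coord = 0 by rw [h, smul_zero])
  have := projPoint_smul x.coord hx0 a ha
  exact this ▸ hx hx0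

theorem zero_mem_cone (W : Set (ProjSpace k n)) : (0 : Fin (n + 1) → k) ∈ cone W :=
  fun h => absurd rfl h

theorem coord_mem_cone_iff {W : Set (ProjSpace k n)} {p : ProjSpace k n} :
    p.coord ∈ cone W ↔ p ∈ W := by
  constructor
  · intro h
    have := h p.coord_ne_zero
    rwa [show projPoint (AffSpace.coord p.coord) p.coord_ne_zero = p from projPoint_coord p] at this
  · intro h _
    exact (projPoint_coord p).symm ▸ h

theorem cone_mono {V W : Set (ProjSpace k n)} (h : V ⊆ W) : cone V ⊆ cone W :=
  fun _ hx h0 => h (hx h0)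

theorem subset_of_cone_subset {V W : Set (ProjSpace k n)} (h : cone V ⊆ cone W) : V ⊆ W :=
  fun _ hp => coord_mem_cone_iff.mp (h (coord_mem_cone_iff.mpr hp))

theorem cone_inter (V W : Set (ProjSpace k n)) : cone (V ∩ W) = cone V ∩ cone W :=
  Set.ext fun _ => forall_and

theorem cone_projZeros (F : Set (MvPolynomial (Fin (n + 1)) k)) :
    cone (projZeros F) =
      -- The factors `X i` put the vertex into the zero set even when `F` contains nonzero
      -- constants.
      affZeros {g | ∃ f ∈ F, (∃ d, f.IsHomogeneous d) ∧ ∃ i, g = f * MvPolynomial.X i} := by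
  ext x
  constructor
  · rintro hx _ ⟨f, hf, ⟨d, hd⟩, i, rfl⟩
    rw [map_mul, MvPolynomial.eval_X]
    by_cases h0 : x.coord = 0
    · rw [h0]; simp
    · rw [(eval_coord_projPoint_eq_zero_iff hd _ h0).mp (hx h0 f hf ⟨d, hd⟩), zero_mul]
  · rintro hx h0 f hf ⟨d, hd⟩
    rw [eval_coord_projPoint_eq_zero_iff hd]
    obtain ⟨i, hi⟩ := Function.ne_iff.mp h0
    have := hx _ ⟨f, hf, ⟨d, hd⟩, i, rfl⟩
    rw [map_mul, MvPolynomial.eval_X] at this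
    exact (mul_eq_zero.mp this).resolve_right hi

theorem isClosed_cone {W : Set (ProjSpace k n)} (hW : IsClosed W) : IsClosed (cone W) := by
  obtain ⟨F, rfl⟩ := ProjSpace.isClosed_iff.mp hW
  rw [cone_projZeros]
  exact isClosed_affZeros _

theorem IsConical.homogeneousComponent_mem_affIdeal [Infinite k] {Y : Set (AffSpace k n)}
    (hY : IsConical Y) {f : MvPolynomial (Fin n) k} (hf : f ∈ affIdeal Y) (i : ℕ) :
    MvPolynomial.homogeneousComponent i f ∈ affIdeal Y := by
  rw [mem_affIdeal]
  intro x hx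
  let q : Polynomial k := ∑ d ∈ Finset.range (f.totalDegree + 1),
    Polynomial.C (MvPolynomial.eval x.coord (MvPolynomial.homogeneousComponent d f)) *
      Polynomial.X ^ d
  have hq : q = 0 := by
    refine Polynomial.funext fun a => ?_
    have h1 := mem_affIdeal.mp hf _ (hY x hx a)
    change MvPolynomial.eval (a • x.coord) f = 0 at h1
    rw [← MvPolynomial.sum_homogeneousComponent f, map_sum] at h1
    rw [Polynomial.eval_zero, ← h1, Polynomial.eval_finsetSum]
    refine Finset.sum_congr rfl fun d _ => ?_
    rw [(MvPolynomial.homogeneousComponent_isHomogeneous d f).eval_smul]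
    rw [Polynomial.eval_mul, Polynomial.eval_C, Polynomial.eval_pow, Polynomial.eval_X, mul_comm]
  by_cases hi : i ∈ Finset.range (f.totalDegree + 1)
  · have h2 := congrArg (fun p => Polynomial.coeff p i) hq
    simp only [q, Polynomial.finsetSum_coeff, Polynomial.coeff_C_mul_X_pow, Polynomial.coeff_zero] at h2
    rw [Finset.sum_ite_eq, if_pos hi] at h2
    exact h2
  · rw [MvPolynomial.homogeneousComponent_eq_zero i f (by simpa using hi), map_zero]

theorem IsConical.isHomogeneous_affIdeal [Infinite k] {Y : Set (AffSpace k n)}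
    (hY : IsConical Y) :
    (affIdeal Y).IsHomogeneous (MvPolynomial.homogeneousSubmodule (Fin n) k) := by
  intro i f hf
  have := hY.homogeneousComponent_mem_affIdeal hf i
  rwa [← MvPolynomial.decomposition.decompose'_apply] at this

/-- The set of points of `ℙⁿ` whose coordinate vectors lie in `Y`. -/
def projOf (Y : Set (AffSpace k (n + 1))) : Set (ProjSpace k n) := {p | p.coord ∈ Y}

theorem IsConical.mem_of_forall_isHomogeneous [Infinite k] {Y : Set (AffSpace k n)}
    (hY : IsConical Y) (hcl : IsClosed Y) {x : AffSpace k n}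
    (hx : ∀ f ∈ affIdeal Y, (∃ d, f.IsHomogeneous d) → MvPolynomial.eval x.coord f = 0) :
    x ∈ Y := by
  rw [← affZeros_affIdeal hcl]
  intro f hf
  rw [← MvPolynomial.sum_homogeneousComponent f, map_sum]
  exact Finset.sum_eq_zero fun d _ => hx _ (hY.homogeneousComponent_mem_affIdeal hf d)
    ⟨d, MvPolynomial.homogeneousComponent_isHomogeneous d f⟩

theorem IsConical.projZeros_affIdeal [Infinite k] {Y : Set (AffSpace k (n + 1))}
    (hY : IsConical Y) (hcl : IsClosed Y) : projZeros (affIdeal Y : Set _) = projOf Y :=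
  Set.ext fun _ => ⟨fun hp => hY.mem_of_forall_isHomogeneous hcl hp, fun hp _ hf _ => hf _ hp⟩

theorem IsConical.cone_projOf {Y : Set (AffSpace k (n + 1))} (hY : IsConical Y)
    (h0 : (0 : Fin (n + 1) → k) ∈ Y) : cone (projOf Y) = Y := by
  ext x
  constructor
  · intro hx
    by_cases hx0 : x.coord = 0
    · exact (show x = (0 : Fin (n + 1) → k) from hx0) ▸ h0
    · obtain ⟨a, ha, h⟩ := exists_smul_eq_coord_projPoint x.coord hx0
      have h1 : (projPoint x.coord hx0).coord ∈ Y := hx hx0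
      rw [h] at h1
      have h2 := hY _ h1 a⁻¹
      rwa [show (a⁻¹ • AffSpace.coord (a • x.coord) : Fin (n + 1) → k) = x from
        inv_smul_smul₀ ha x.coord] at h2
  · intro hx hx0
    obtain ⟨a, ha, h⟩ := exists_smul_eq_coord_projPoint x.coord hx0
    change (projPoint x.coord hx0).coord ∈ Y
    rw [h]
    exact hY x hx a

/-- A homogeneous ideal is prime once this holds for homogeneous elements, and their zero sets make
sense in projective space, where `Z` is irreducible. -/
theorem isIrreducible_cone [Infinite k] {Z : Set (ProjSpace k n)} (hZ : IsIrreducible Z) :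
    IsIrreducible (cone Z) := by
  apply isIrreducible_of_affIdeal_isPrime
  refine (isConical_cone Z).isHomogeneous_affIdeal.isPrime_of_homogeneous_mem_or_mem ?_ ?_
  · rw [Ideal.ne_top_iff_one]
    intro h
    have := mem_affIdeal.mp h _ (zero_mem_cone Z)
    simp at this
  · rintro f g ⟨d, hf⟩ ⟨e, hg⟩ hfg
    have key : ∀ {f : MvPolynomial (Fin (n + 1)) k} {d : ℕ}, f.IsHomogeneous d →
        Z ⊆ projZeros {f} → f ∈ affIdeal (cone Z) := by
      intro f d hf hZf
      rw [mem_affIdeal]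
      intro x hx
      by_cases hx0 : x.coord = 0
      · obtain ⟨p, hp⟩ := hZ.nonempty
        rw [hx0, ← zero_smul k p.coord, hf.eval_smul, hZf hp f rfl ⟨d, hf⟩, mul_zero]
      · exact (eval_coord_projPoint_eq_zero_iff hf _ hx0).mp (hZf (hx hx0) f rfl ⟨d, hf⟩)
    refine (isPreirreducible_iff_isClosed_union_isClosed.mp hZ.isPreirreducible
      (projZeros {f}) (projZeros {g}) (isClosed_projZeros _) (isClosed_projZeros _) ?_).imp
      (key hf) (key hg)
    intro p hp
    have := mem_affIdeal.mp hfg _ (coord_mem_cone_iff.mpr hp)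
    rw [map_mul, mul_eq_zero] at this
    refine this.imp (fun h => ?_) (fun h => ?_)
    · rintro _ rfl -
      exact h
    · rintro _ rfl -
      exact h

theorem IsConical.zero_mem {Y : Set (AffSpace k n)} (hY : IsConical Y) (hne : Y.Nonempty) :
    (0 : Fin n → k) ∈ Y := by
  obtain ⟨x, hx⟩ := hne
  exact zero_smul k x.coord ▸ hY x hx 0

theorem isIrreducible_projOf {Y : Set (AffSpace k (n + 1))} (hY : IsConical Y)
    (hirr : IsIrreducible Y) (hne : (projOf Y).Nonempty) : IsIrreducible (projOf Y) := by
  refine ⟨hne, isPreirreducible_iff_isClosed_union_isClosed.mpr fun z₁ z₂ h₁ h₂ h => ?_⟩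
  have hc := hY.cone_projOf (hY.zero_mem hirr.nonempty)
  have := isPreirreducible_iff_isClosed_union_isClosed.mp hirr.isPreirreducible
    (cone z₁) (cone z₂) (isClosed_cone h₁) (isClosed_cone h₂) ?_
  · rw [← hc] at this
    exact this.imp subset_of_cone_subset subset_of_cone_subset
  · intro x hx
    by_cases hx0 : x.coord = 0
    · exact Or.inl fun h' => absurd hx0 h'
    · rw [← hc] at hx
      exact (h (hx hx0)).imp (fun h _ => h) (fun h _ => h)

/-- The homogeneous core of a prime ideal is prime, and it still contains all homogeneous
polynomials that vanish on `W`. Thus dimension can be tested on conical irreducible sets alone. -/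
theorem exists_conical_between [IsAlgClosed k] (Y : IrreducibleCloseds (AffSpace k n))
    {W : Set (AffSpace k n)} (hW : IsConical W) (hcl : IsClosed W) (hYW : (Y : Set _) ⊆ W) :
    ∃ Y' : IrreducibleCloseds (AffSpace k n), IsConical (Y' : Set (AffSpace k n)) ∧ Y ≤ Y' ∧
      (Y' : Set (AffSpace k n)) ⊆ W := by
  have : Infinite k := IsAlgClosed.instInfinite
  have hp := affIdeal_isPrime Y.isIrreducible
  let q := (affIdeal (Y : Set (AffSpace k n))).homogeneousCore
    (MvPolynomial.homogeneousSubmodule (Fin n) k)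
  have hq : q.toIdeal.IsPrime := hp.homogeneousCore
  have hqp : q.toIdeal ≤ affIdeal (Y : Set (AffSpace k n)) := Ideal.toIdeal_homogeneousCore_le _ _
  refine ⟨primeZeros q.toIdeal, ?_, ?_, ?_⟩
  · intro x hx a f hf
    change MvPolynomial.eval (a • x.coord) f = 0
    rw [← MvPolynomial.sum_homogeneousComponent f, map_sum]
    refine Finset.sum_eq_zero fun d _ => ?_
    rw [(MvPolynomial.homogeneousComponent_isHomogeneous d f).eval_smul,
      hx _ (MvPolynomial.homogeneousComponent_mem_of_mem q.isHomogeneous hf d), mul_zero]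
  · exact subset_affZeros_iff.mpr hqp
  · intro x hx
    refine hW.mem_of_forall_isHomogeneous hcl fun f hf hd => hx f ?_
    exact Ideal.mem_homogeneousCore_of_homogeneous_of_mem hd (affIdeal_anti hYW hf)

theorem exists_ne_of_one_le_topologicalKrullDim {X : Type*} [TopologicalSpace X] {V : Set X}
    (hV : IsClosed V) (h : ((0 + 1 : ℕ) : WithBot ℕ∞) ≤ topologicalKrullDim V) (a : X) :
    ∃ x ∈ V, x ≠ a := by
  obtain ⟨l, hl, hlast⟩ := (le_topologicalKrullDim_iff hV _).mp h
  by_contra! hc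
  have hlt : l.head < l.last := by
    refine l.strictMono ?_
    rw [Fin.lt_def]
    simp [hl]
  obtain ⟨y, hy⟩ := l.head.isIrreducible.nonempty
  refine hlt.not_ge fun x hx => ?_
  rw [hc x (hlast hx), ← hc y (hlast (hlt.le hy))]
  exact hy

theorem natCast_le_topologicalKrullDim_projOf [IsAlgClosed k] (s : ℕ) :
    ∀ Y : IrreducibleCloseds (AffSpace k (n + 1)), IsConical (Y : Set (AffSpace k (n + 1))) →
      ((s + 1 : ℕ) : WithBot ℕ∞) ≤ topologicalKrullDim (Y : Set (AffSpace k (n + 1))) →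
      (s : WithBot ℕ∞) ≤ topologicalKrullDim (projOf (Y : Set (AffSpace k (n + 1)))) := by
  have : Infinite k := IsAlgClosed.instInfinite
  have hpt : ∀ Y : IrreducibleCloseds (AffSpace k (n + 1)),
      IsConical (Y : Set (AffSpace k (n + 1))) → ∀ s : ℕ,
      ((s + 1 : ℕ) : WithBot ℕ∞) ≤ topologicalKrullDim (Y : Set (AffSpace k (n + 1))) →
      ∃ p, p ∈ projOf (Y : Set (AffSpace k (n + 1))) := by
    intro Y hY s h
    obtain ⟨x, hx, hx0⟩ := exists_ne_of_one_le_topologicalKrullDim Y.isClosed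
      (le_trans (by exact_mod_cast (by omega : 0 + 1 ≤ s + 1)) h) (0 : Fin (n + 1) → k)
    obtain ⟨a, -, h⟩ := exists_smul_eq_coord_projPoint x hx0
    refine ⟨projPoint x hx0, ?_⟩
    change (projPoint x hx0).coord ∈ (Y : Set (AffSpace k (n + 1)))
    rw [h]
    exact hY x hx a
  induction s with
  | zero =>
    intro Y hY h
    exact_mod_cast zero_le_topologicalKrullDim_iff.mpr (hpt Y hY 0 h)
  | succ s ih =>
    intro Y hY h
    obtain ⟨p, hp⟩ := hpt Y hY _ h
    -- Cutting by `X i` removes `p`, so the projectivization shrinks strictly, while the cone still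
    -- contains the vertex and loses at most one dimension.
    obtain ⟨i, hi⟩ := Function.ne_iff.mp p.coord_ne_zero
    have h0 := hY.zero_mem Y.isIrreducible.nonempty
    have h1 := le_topologicalKrullDim_inter_affZeros Y.isClosed Y.isIrreducible h0
      (f := MvPolynomial.X i) (by rw [MvPolynomial.eval_X]; rfl) h
    have hZcl : IsClosed ((Y : Set (AffSpace k (n + 1))) ∩ affZeros {MvPolynomial.X i}) :=
      Y.isClosed.inter (isClosed_affZeros _)
    have hZ : IsConical ((Y : Set (AffSpace k (n + 1))) ∩ affZeros {MvPolynomial.X i}) := by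
      rintro x ⟨hx, hxi⟩ a
      refine ⟨hY x hx a, ?_⟩
      rintro _ rfl
      have := hxi _ rfl
      rw [MvPolynomial.eval_X] at this ⊢
      change a * x.coord i = 0
      rw [this, mul_zero]
    obtain ⟨Y', hY', hdim⟩ := exists_irreducible_of_le_topologicalKrullDim hZcl h1
    obtain ⟨Y'', hcon, hle, hsub⟩ := exists_conical_between Y' hZ hZcl hY'
    have hdim'' := hdim.trans (topologicalKrullDim_mono hle)
    have h2 := ih Y'' hcon hdim''
    have hcl : ∀ Y : IrreducibleCloseds (AffSpace k (n + 1)),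
        IsConical (Y : Set (AffSpace k (n + 1))) →
        IsClosed (projOf (Y : Set (AffSpace k (n + 1)))) := fun Y hY => by
      rw [← hY.projZeros_affIdeal Y.isClosed]
      exact isClosed_projZeros _
    let P : IrreducibleCloseds (ProjSpace k n) :=
      ⟨_, isIrreducible_projOf hY Y.isIrreducible ⟨p, hp⟩, hcl Y hY⟩
    let P'' : IrreducibleCloseds (ProjSpace k n) :=
      ⟨_, isIrreducible_projOf hcon Y''.isIrreducible (hpt Y'' hcon s hdim''), hcl Y'' hcon⟩
    refine succ_le_topologicalKrullDim_of_lt (Z := P'') (Y := P) (lt_of_le_not_ge ?_ ?_) h2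
    · exact fun q hq => (hsub hq).1
    · intro hge
      have := (hsub (hge hp)).2 _ rfl
      rw [MvPolynomial.eval_X] at this
      exact hi this

/-- The affine cone has one dimension more. -/
theorem natCast_le_topologicalKrullDim_cone_iff [IsAlgClosed k] {W : Set (ProjSpace k n)}
    (hW : IsClosed W) (s : ℕ) : ((s + 1 : ℕ) : WithBot ℕ∞) ≤ topologicalKrullDim (cone W) ↔
      (s : WithBot ℕ∞) ≤ topologicalKrullDim W := by
  have : Infinite k := IsAlgClosed.instInfinite
  constructor
  · intro h
    obtain ⟨Y, hY, hdim⟩ := exists_irreducible_of_le_topologicalKrullDim (isClosed_cone hW) h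
    obtain ⟨Y', hcon, hle, hsub⟩ := exists_conical_between Y (isConical_cone W) (isClosed_cone hW) hY
    refine (natCast_le_topologicalKrullDim_projOf s Y' hcon
      (hdim.trans (topologicalKrullDim_mono hle))).trans (topologicalKrullDim_mono ?_)
    exact fun p hp => coord_mem_cone_iff.mp (hsub hp)
  · intro h
    obtain ⟨l, hl, hlast⟩ := (le_topologicalKrullDim_iff hW s).mp h
    let c : IrreducibleCloseds (ProjSpace k n) → IrreducibleCloseds (AffSpace k (n + 1)) :=
      fun Z => ⟨cone (Z : Set (ProjSpace k n)), isIrreducible_cone Z.isIrreducible,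
        isClosed_cone Z.isClosed⟩
    have hc : StrictMono c := fun Z Z' hlt =>
      lt_of_le_not_ge (cone_mono hlt.le) fun h' => hlt.not_ge (subset_of_cone_subset h')
    have hzero : IsClosed ({(0 : Fin (n + 1) → k)} : Set (AffSpace k (n + 1))) := by
      refine AffSpace.isClosed_iff.mpr ⟨Set.range MvPolynomial.X, ?_⟩
      ext x
      refine ⟨fun hx => funext fun i => ?_, ?_⟩
      · have := hx _ ⟨i, rfl⟩
        rwa [MvPolynomial.eval_X] at this
      · rintro rfl _ ⟨i, rfl⟩
        rw [MvPolynomial.eval_X]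
        rfl
    let O : IrreducibleCloseds (AffSpace k (n + 1)) :=
      ⟨{(0 : Fin (n + 1) → k)}, isIrreducible_singleton, hzero⟩
    -- The vertex, put below the chain of cones, supplies the extra step.
    have hO : O < (l.map c hc).head := by
      refine lt_of_le_not_ge ?_ fun h' => ?_
      · rintro _ rfl
        exact zero_mem_cone _
      · obtain ⟨p, hp⟩ := l.head.isIrreducible.nonempty
        exact p.coord_ne_zero (h' (coord_mem_cone_iff.mpr hp))
    refine (le_topologicalKrullDim_iff (isClosed_cone hW) _).mpr
      ⟨RelSeries.cons (l.map c hc) O hO, ?_, ?_⟩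
    · rw [RelSeries.cons_length]
      exact congrArg (· + 1) hl
    · rw [RelSeries.last_cons]
      exact cone_mono hlast

/-- On the cone, the linear form vanishes at the vertex, so the affine principal ideal theorem
applies without any assumption that the intersection is nonempty. -/
theorem natCast_le_topologicalKrullDim_inter_projZeros [IsAlgClosed k] {W : Set (ProjSpace k n)}
    (hW : IsClosed W) {f : MvPolynomial (Fin (n + 1)) k} (hf : f.IsHomogeneous 1) {s : ℕ}
    (h : ((s + 1 : ℕ) : WithBot ℕ∞) ≤ topologicalKrullDim W) :
    (s : WithBot ℕ∞) ≤ topologicalKrullDim (W ∩ projZeros {f} : Set (ProjSpace k n)) := by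
  rw [← natCast_le_topologicalKrullDim_cone_iff hW] at h
  rw [← natCast_le_topologicalKrullDim_cone_iff (hW.inter (isClosed_projZeros _))]
  obtain ⟨Y, hY, hdim⟩ := exists_irreducible_of_le_topologicalKrullDim (isClosed_cone hW) h
  obtain ⟨Y', hcon, hle, hsub⟩ := exists_conical_between Y (isConical_cone W) (isClosed_cone hW) hY
  have h0 := hcon.zero_mem Y'.isIrreducible.nonempty
  have hf0 : MvPolynomial.eval (0 : Fin (n + 1) → k) f = 0 := by
    have := hf.eval_smul 0 0
    rwa [smul_zero, pow_one, zero_mul] at this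
  refine (le_topologicalKrullDim_inter_affZeros Y'.isClosed Y'.isIrreducible h0 hf0
    (hdim.trans (topologicalKrullDim_mono hle))).trans (topologicalKrullDim_mono ?_)
  rw [cone_inter]
  refine Set.inter_subset_inter hsub fun x hx hx0 => ?_
  rintro _ rfl -
  exact (eval_coord_projPoint_eq_zero_iff hf _ hx0).mpr (hx _ rfl)

/-- The linear form with given coefficients. -/
noncomputable def linForm {m : ℕ} (v : Fin m → k) : MvPolynomial (Fin m) k :=
  ∑ j, MvPolynomial.C (v j) * MvPolynomial.X j

theorem linForm_isHomogeneous {m : ℕ} (v : Fin m → k) : (linForm v).IsHomogeneous 1 :=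
  MvPolynomial.IsHomogeneous.sum _ _ _ fun j _ => MvPolynomial.isHomogeneous_C_mul_X _ j

theorem eval_linForm {m : ℕ} (v x : Fin m → k) :
    MvPolynomial.eval x (linForm v) = ∑ j, v j * x j := by
  simp [linForm]

theorem nonempty_inter_projLinear [IsAlgClosed k] {s : ℕ} : ∀ {Z : Set (ProjSpace k n)},
    IsClosed Z → (s : WithBot ℕ∞) ≤ topologicalKrullDim Z → ∀ A : Fin s → Fin (n + 1) → k,
    (Z ∩ projLinear A).Nonempty := by
  induction s with
  | zero =>
    intro Z _ h A
    obtain ⟨x, hx⟩ := zero_le_topologicalKrullDim_iff.mp (by exact_mod_cast h)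
    exact ⟨x, hx, fun i => i.elim0⟩
  | succ s ih =>
    intro Z hZ h A
    have h1 := natCast_le_topologicalKrullDim_inter_projZeros hZ (linForm_isHomogeneous (A 0)) h
    obtain ⟨p, ⟨hp, hp0⟩, hpA⟩ := ih (hZ.inter (isClosed_projZeros _)) h1 (fun i => A i.succ)
    refine ⟨p, hp, Fin.cases ?_ hpA⟩
    have := hp0 _ rfl ⟨1, linForm_isHomogeneous _⟩
    rwa [eval_linForm] at this

theorem ProjIrredDegree.pos [IsAlgClosed k] {Z : Set (ProjSpace k n)} (hZ : IsClosed Z) {d : ℕ}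
    (h : ProjIrredDegree Z d) : 0 < d := by
  have : Infinite k := IsAlgClosed.instInfinite
  obtain ⟨s, hs, P, hP, hA⟩ := h
  obtain ⟨a, ha⟩ : ∃ a, MvPolynomial.eval a P ≠ 0 := by
    by_contra! hc
    exact hP (MvPolynomial.funext fun x => by rw [hc x, map_zero])
  have h1 := hA (fun i j => a (i, j)) ha
  have h2 := nonempty_inter_projLinear hZ (zariskiDim_eq_natCast_iff.mp hs).ge fun i j => a (i, j)
  rw [← Set.encard_ne_zero, h1] at h2
  exact Nat.pos_of_ne_zero (by exact_mod_cast h2)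

/-- Coordinates outside `J` are scalars in the coordinate ring, so those in `J` generate it. -/
theorem trdeg_coordRing_le_of_coord_const {Z : Set (AffSpace k n)} (J : Finset (Fin n))
    [IsDomain (coordRing Z)]
    (h : ∀ j ∉ J, ∃ a : k, ∀ x ∈ Z, x.coord j = a) : Algebra.trdeg k (coordRing Z) ≤ J.card := by
  let g : Fin n → coordRing Z := fun j => Ideal.Quotient.mk _ (MvPolynomial.X j)
  let A := Algebra.adjoin k (g '' J)
  have htop : ∀ y : coordRing Z, y ∈ A := by
    intro y
    obtain ⟨f, rfl⟩ := Ideal.Quotient.mk_surjective y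
    induction f using MvPolynomial.induction_on with
    | C a => exact A.algebraMap_mem a
    | add p q hp hq => rw [map_add]; exact add_mem hp hq
    | mul_X p j hp =>
      rw [map_mul]
      refine mul_mem hp ?_
      by_cases hj : j ∈ J
      · exact Algebra.subset_adjoin ⟨j, hj, rfl⟩
      · obtain ⟨a, ha⟩ := h j hj
        have : g j = algebraMap k _ a := by
          refine (Ideal.Quotient.eq (y := MvPolynomial.C a)).mpr ?_
          rw [mem_affIdeal]
          intro x hx
          simp [ha x hx]
        change g j ∈ A
        exact this ▸ A.algebraMap_mem a
  have halg : Algebra.IsAlgebraic A (coordRing Z) :=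
    ⟨fun y => isAlgebraic_algebraMap (⟨y, htop y⟩ : A)⟩
  refine (Algebra.IsAlgebraic.trdeg_le_cardinalMk k (g '' J)).trans ?_
  have := Cardinal.mk_image_le_lift (f := g) (s := (J : Set (Fin n)))
  simpa using this

end ProjectiveGeometry

/-! ### Noether normalization by generic linear forms. -/

section LinearNoetherNormalization

theorem MvPolynomial.homogeneousComponent_totalDegree_ne_zero {σ R : Type*} [CommSemiring R]
    {F : MvPolynomial σ R} (hF : F ≠ 0) : MvPolynomial.homogeneousComponent F.totalDegree F ≠ 0 := by
  obtain ⟨m, hm, h⟩ := Finset.exists_mem_eq_sup F.support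
    (MvPolynomial.support_nonempty.mpr hF) (fun m => m.sum fun _ e => e)
  intro h0
  have h1 := congrArg (MvPolynomial.coeff m) h0
  rw [MvPolynomial.coeff_homogeneousComponent, if_pos, MvPolynomial.coeff_zero] at h1
  · exact MvPolynomial.mem_support_iff.mp hm h1
  · exact h.symm

theorem MvPolynomial.homogeneousComponent_map {σ R S : Type*} [CommSemiring R] [CommSemiring S]
    (f : R →+* S) (e : ℕ) (F : MvPolynomial σ R) :
    MvPolynomial.homogeneousComponent e (MvPolynomial.map f F) =
      MvPolynomial.map f (MvPolynomial.homogeneousComponent e F) := by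
  ext m
  rw [MvPolynomial.coeff_map, MvPolynomial.coeff_homogeneousComponent,
    MvPolynomial.coeff_homogeneousComponent, MvPolynomial.coeff_map]
  split_ifs <;> simp

theorem MvPolynomial.exists_eval_ne_zero {σ k : Type*} [Field k] [Infinite k]
    {P : MvPolynomial σ k} (hP : P ≠ 0) : ∃ a, MvPolynomial.eval a P ≠ 0 := by
  by_contra! hc
  exact hP (MvPolynomial.funext fun x => by rw [hc x, map_zero])

/-- The restriction of a polynomial of degree at most `e` to the line `c + τ w`: its coefficient of
`τ ^ e` is the value at `w` of the component of degree `e`. -/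
theorem MvPolynomial.natDegree_le_and_coeff_line {σ k B : Type*} [Field k] [CommRing B] [Algebra k B]
    (c : σ → B) (w : σ → k) {e : ℕ} (F : MvPolynomial σ k) (hF : F.totalDegree ≤ e) :
    (MvPolynomial.aeval (fun i => Polynomial.C (c i) +
      Polynomial.C (algebraMap k B (w i)) * Polynomial.X) F).natDegree ≤ e ∧
    (MvPolynomial.aeval (fun i => Polynomial.C (c i) +
      Polynomial.C (algebraMap k B (w i)) * Polynomial.X) F).coeff e =
      algebraMap k B (MvPolynomial.eval w (MvPolynomial.homogeneousComponent e F)) := by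
  set L : σ → Polynomial B := fun i => Polynomial.C (c i) +
      Polynomial.C (algebraMap k B (w i)) * Polynomial.X with hL
  have hL1 (i) : (L i).natDegree ≤ 1 := by
    exact Polynomial.natDegree_add_le_of_degree_le (by simp) 
      ((Polynomial.natDegree_C_mul_le _ _).trans Polynomial.natDegree_X_le)
  have hL2 (i) : (L i).coeff 1 = algebraMap k B (w i) := by
    simp [hL, Polynomial.coeff_C]
  have hmon : ∀ (m : σ →₀ ℕ), (m.prod fun i d => L i ^ d).natDegree ≤ m.degree ∧
      (m.prod fun i d => L i ^ d).coeff m.degree =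
        algebraMap k B (m.prod fun i d => w i ^ d) := by
    intro m
    rw [Finsupp.degree_apply, Finsupp.prod, Finsupp.prod]
    induction m.support using Finset.cons_induction with
    | empty => simp
    | cons i s hi ih =>
      rw [Finset.prod_cons, Finset.prod_cons, Finset.sum_cons]
      have hp : (L i ^ m i).natDegree ≤ m i :=
        (Polynomial.natDegree_pow_le_of_le _ (hL1 i)).trans (by simp)
      refine ⟨Polynomial.natDegree_mul_le_of_le hp ih.1, ?_⟩
      rw [Polynomial.coeff_mul_add_eq_of_natDegree_le hp ih.1, ih.2, map_mul, map_pow]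
      congr 1
      have := Polynomial.coeff_pow_of_natDegree_le (m := m i) (hL1 i)
      rwa [mul_one, hL2] at this
  have hexp : MvPolynomial.aeval L F = ∑ m ∈ F.support,
      Polynomial.C (algebraMap k B (F.coeff m)) * m.prod fun i d => L i ^ d := by
    rw [MvPolynomial.aeval_def, MvPolynomial.eval₂_eq]
    rfl
  have hdeg : ∀ m ∈ F.support, m.degree ≤ e := fun m hm =>
    (MvPolynomial.le_totalDegree hm).trans hF
  constructor
  · rw [hexp]
    refine Polynomial.natDegree_sum_le_of_forall_le _ _ fun m hm => ?_
    exact (Polynomial.natDegree_C_mul_le _ _).trans ((hmon m).1.trans (hdeg m hm))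
  · rw [hexp, Polynomial.finsetSum_coeff, MvPolynomial.homogeneousComponent_apply, map_sum, map_sum,
      Finset.sum_filter]
    refine Finset.sum_congr rfl fun m hm => ?_
    rw [Polynomial.coeff_C_mul]
    split_ifs with h
    · rw [← h, (hmon m).2, MvPolynomial.eval_monomial, map_mul]
    · rw [Polynomial.coeff_eq_zero_of_natDegree_lt, mul_zero]
      exact lt_of_le_of_lt (hmon m).1 (lt_of_le_of_ne (hdeg m hm) h)

universe u

variable {k R : Type u} [Field k] [CommRing R] [IsDomain R] [Algebra k R] {n s : ℕ}

/-- Adjoin indeterminate coefficients `U`. Then `R[U]` has transcendence degree `s + s n`, while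
`y`, the `s` generic combinations and the `s n` indeterminates are one element too many. The
resulting relation can be specialized at every `u`. -/
theorem exists_relation_of_trdeg (hR : Algebra.trdeg k R = s) (x : Fin n → R) (y : R) :
    ∃ F : MvPolynomial (Option (Fin s)) (MvPolynomial (Fin s × Fin n) k), F ≠ 0 ∧
      ∀ u : Fin s × Fin n → k,
        MvPolynomial.aeval (fun o : Option (Fin s) => o.elim y fun i => ∑ l, u (i, l) • x l)
          (MvPolynomial.map (MvPolynomial.eval u) F) = 0 := by
  let v : Option (Fin s) ⊕ (Fin s × Fin n) → MvPolynomial (Fin s × Fin n) R := Sum.elim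
    (fun o => o.elim (MvPolynomial.C y)
      fun i => ∑ l, MvPolynomial.X (i, l) * MvPolynomial.C (x l)) MvPolynomial.X
  have hdep : ¬ AlgebraicIndependent k v := by
    intro h
    have h1 := h.lift_cardinalMk_le_trdeg
    have h2 := trdeg_add_eq k R (A := MvPolynomial (Fin s × Fin n) R)
    rw [MvPolynomial.trdeg_of_isDomain, hR] at h2
    rw [← h2] at h1
    simp only [Cardinal.mk_fintype, Fintype.card_sum, Fintype.card_option, Fintype.card_fin,
      Fintype.card_prod, Cardinal.lift_natCast] at h1
    norm_cast at h1
    rw [Cardinal.lift_natCast, Nat.cast_le] at h1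
    omega
  rw [algebraicIndependent_iff] at hdep
  push Not at hdep
  obtain ⟨G, hG, hG0⟩ := hdep
  refine ⟨MvPolynomial.sumAlgEquiv k _ _ G, by simpa using hG0, fun u => ?_⟩
  let σ : MvPolynomial (Fin s × Fin n) R →ₐ[k] R := (MvPolynomial.aeval
    (fun ij => algebraMap k R (u ij)) : MvPolynomial (Fin s × Fin n) R →ₐ[R] R).restrictScalars k
  let τ : MvPolynomial (Option (Fin s)) (MvPolynomial (Fin s × Fin n) k) →ₐ[k]
      MvPolynomial (Option (Fin s)) k := MvPolynomial.mapAlgHom (MvPolynomial.aeval u)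
  let ψ : MvPolynomial (Option (Fin s)) k →ₐ[k] R :=
    MvPolynomial.aeval (fun o : Option (Fin s) => o.elim y fun i => ∑ l, u (i, l) • x l)
  have key : (ψ.comp τ).comp (MvPolynomial.sumAlgEquiv k _ _).toAlgHom =
      σ.comp (MvPolynomial.aeval v) := by
    ext o
    rcases o with (_ | i) | ij
    · simp [ψ, τ, σ, v]
    · simp [ψ, τ, σ, v, Algebra.smul_def]
    · simp [ψ, τ, σ, v, Algebra.smul_def]
  have := DFunLike.congr_fun key G
  simp only [AlgHom.comp_apply, hG, map_zero] at this
  exact this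

/-- The homomorphism from a polynomial ring that sends the variables to the linear combinations of
`x` with coefficients `v`. -/
noncomputable def linMap (x : Fin n → R) (v : Fin s × Fin n → k) : MvPolynomial (Fin s) k →ₐ[k] R :=
  MvPolynomial.aeval fun i => ∑ l, v (i, l) • x l

/-- Shifting the `i`-th form by `w_i x_j` turns the algebraic relation into a polynomial equation
for `x_j` over the unshifted forms. Its leading coefficient is the top homogeneous part at `w`, a
scalar that is nonzero for general coefficients. -/
theorem exists_isIntegralElem_linMap [Infinite k] (hR : Algebra.trdeg k R = s) (x : Fin n → R)
    (j : Fin n) : ∃ h : MvPolynomial (Fin s × Fin n) k, h ≠ 0 ∧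
      ∀ v, MvPolynomial.eval v h ≠ 0 → (linMap x v).toRingHom.IsIntegralElem (x j) := by
  obtain ⟨F, hF0, hF⟩ := exists_relation_of_trdeg hR x (x j)
  set e := F.totalDegree with he
  set Fe := MvPolynomial.homogeneousComponent e F with hFe
  have hFe0 : Fe ≠ 0 := MvPolynomial.homogeneousComponent_totalDegree_ne_zero hF0
  obtain ⟨m, hm⟩ := MvPolynomial.ne_zero_iff.mp hFe0
  obtain ⟨u₀, hu₀⟩ := MvPolynomial.exists_eval_ne_zero hm
  let G := MvPolynomial.map (MvPolynomial.eval u₀) Fe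
  have hG : G ≠ 0 := MvPolynomial.ne_zero_iff.mpr ⟨m, by rwa [MvPolynomial.coeff_map]⟩
  have hGh : G.IsHomogeneous e := (MvPolynomial.homogeneousComponent_isHomogeneous e F).map _
  -- The factor `X none` makes the entry for `x j` nonzero; homogeneity then allows it to be scaled
  -- to 1.
  obtain ⟨w₀, hw₀⟩ := MvPolynomial.exists_eval_ne_zero (mul_ne_zero hG (MvPolynomial.X_ne_zero none))
  rw [map_mul, MvPolynomial.eval_X] at hw₀
  obtain ⟨hw₀G, hw₀n⟩ := mul_ne_zero_iff.mp hw₀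
  let w : Option (Fin s) → k := (w₀ none)⁻¹ • w₀
  have hwn : w none = 1 := inv_mul_cancel₀ hw₀n
  have hwG : MvPolynomial.eval w G ≠ 0 := by
    rw [hGh.eval_smul]
    exact mul_ne_zero (pow_ne_zero _ (inv_ne_zero hw₀n)) hw₀G
  let H : MvPolynomial (Fin s × Fin n) k := MvPolynomial.eval (fun i => MvPolynomial.C (w i)) Fe
  have hH : ∀ u, MvPolynomial.eval u H =
      MvPolynomial.eval w (MvPolynomial.map (MvPolynomial.eval u) Fe) := by
    intro u
    have : (MvPolynomial.eval u).comp (MvPolynomial.eval (fun i => MvPolynomial.C (w i))) =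
        (MvPolynomial.eval w).comp (MvPolynomial.map (MvPolynomial.eval u)) :=
      MvPolynomial.ringHom_ext (by simp) (by simp)
    exact DFunLike.congr_fun this Fe
  -- With coefficients `v + sh` the `i`-th form at `x` is the form of `v` plus `w (some i) • x j`.
  let sh : Fin s × Fin n → k := fun il => if il.2 = j then w (some il.1) else 0
  let h : MvPolynomial (Fin s × Fin n) k :=
    MvPolynomial.aeval (fun il => MvPolynomial.X il + MvPolynomial.C (sh il)) H
  have hh : ∀ v, MvPolynomial.eval v h = MvPolynomial.eval (v + sh) H := by
    intro v
    have : (MvPolynomial.aeval v).comp (MvPolynomial.aeval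
        (fun il => MvPolynomial.X il + MvPolynomial.C (sh il))) =
        (MvPolynomial.aeval (v + sh) : MvPolynomial (Fin s × Fin n) k →ₐ[k] k) := by
      ext il; simp
    exact DFunLike.congr_fun this H
  refine ⟨h, ?_, fun v hv => ?_⟩
  · intro h0
    have := hh (u₀ - sh)
    rw [h0, map_zero, sub_add_cancel, hH] at this
    exact hwG this.symm
  · rw [hh] at hv
    set u := v + sh with hu
    let Fu := MvPolynomial.map (MvPolynomial.eval u) F
    have hFu : Fu.totalDegree ≤ e := Finset.sup_mono (MvPolynomial.support_map_subset _ _)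
    let c : Option (Fin s) → MvPolynomial (Fin s) k := fun o => o.elim 0 MvPolynomial.X
    obtain ⟨hd, hc⟩ := MvPolynomial.natDegree_le_and_coeff_line c w Fu hFu
    set p := MvPolynomial.aeval (fun i => Polynomial.C (c i) +
      Polynomial.C (algebraMap k (MvPolynomial (Fin s) k) (w i)) * Polynomial.X) Fu with hp
    rw [MvPolynomial.homogeneousComponent_map, ← hFe, ← hH] at hc
    set a := MvPolynomial.eval u H with ha
    refine ⟨Polynomial.C (MvPolynomial.C a⁻¹) * p, ?_, ?_⟩
    · refine Polynomial.monic_of_natDegree_le_of_coeff_eq_one e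
        ((Polynomial.natDegree_C_mul_le _ _).trans hd) ?_
      rw [Polynomial.coeff_C_mul, hc, MvPolynomial.algebraMap_eq, ← map_mul, inv_mul_cancel₀ hv,
        map_one]
    · rw [Polynomial.eval₂_mul]
      have h2 : Polynomial.eval₂ (linMap x v).toRingHom (x j) p = 0 := by
        have h3 : (Polynomial.eval₂RingHom (linMap x v).toRingHom (x j)).comp
            (MvPolynomial.aeval (fun i => Polynomial.C (c i) +
              Polynomial.C (algebraMap k (MvPolynomial (Fin s) k) (w i)) *
                Polynomial.X)).toRingHom =
            (MvPolynomial.aeval (R := k) (fun o : Option (Fin s) =>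
              o.elim (x j) fun i => ∑ l, u (i, l) • x l)).toRingHom := by
          refine MvPolynomial.ringHom_ext (fun a => ?_) (fun o => ?_)
          · simp [Polynomial.algebraMap_apply]
          rcases o with _ | i
          · simp [c, hwn]
          · simp [c, linMap, hu, sh, Finset.sum_add_distrib, Algebra.smul_def, add_mul,
              apply_ite (algebraMap k R), ite_mul]
        have := DFunLike.congr_fun h3 Fu
        exact this.trans (hF u)
      rw [h2, mul_zero]

/-- Noether normalization by linear forms with coefficients outside a given hypersurface. -/
theorem exists_linMap_isIntegral [Infinite k] (hR : Algebra.trdeg k R = s) (x : Fin n → R)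
    (hx : Function.Surjective (MvPolynomial.aeval (R := k) x))
    {P : MvPolynomial (Fin s × Fin (n + 1)) k} (hP : P ≠ 0) :
    ∃ A : Fin s × Fin (n + 1) → k, MvPolynomial.eval A P ≠ 0 ∧
      (linMap x fun il : Fin s × Fin n => A (il.1, il.2.succ)).toRingHom.IsIntegral := by
  choose h h0 hint using exists_isIntegralElem_linMap hR x
  let ι : Fin s × Fin n → Fin s × Fin (n + 1) := fun il => (il.1, il.2.succ)
  have hι : Function.Injective ι := by
    rintro ⟨i, l⟩ ⟨i', l'⟩ h
    simpa [ι] using h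
  -- One point must avoid `P` and the bad loci of all generators; `ι` skips the column of constant
  -- terms.
  have hprod : P * ∏ j, MvPolynomial.rename ι (h j) ≠ 0 :=
    mul_ne_zero hP (Finset.prod_ne_zero_iff.mpr fun j _ h' =>
      h0 j (MvPolynomial.rename_injective ι hι (by rw [h', map_zero])))
  obtain ⟨A, hA⟩ := MvPolynomial.exists_eval_ne_zero hprod
  rw [map_mul, map_prod, mul_ne_zero_iff, Finset.prod_ne_zero_iff] at hA
  refine ⟨A, hA.1, fun y => ?_⟩
  have hxj : ∀ j, (linMap x fun il => A (ι il)).toRingHom.IsIntegralElem (x j) := fun j => by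
    refine hint j _ ?_
    have := hA.2 j (Finset.mem_univ j)
    rwa [MvPolynomial.eval_rename] at this
  obtain ⟨f, rfl⟩ := hx y
  induction f using MvPolynomial.induction_on with
  | C a =>
    have := RingHom.isIntegralElem_map (linMap x fun il => A (ι il)).toRingHom
      (x := algebraMap k _ a)
    rw [MvPolynomial.aeval_C]
    rwa [show (linMap x fun il => A (ι il)).toRingHom (algebraMap k _ a) = algebraMap k R a from
      (linMap x fun il => A (ι il)).commutes a] at this
  | add p q hp hq => rw [map_add]; exact hp.add _ hq
  | mul_X p j hp => rw [map_mul, MvPolynomial.aeval_X]; exact hp.mul _ (hxj j)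

/-- `R` is algebraic over the subalgebra generated by `s` elements, and `s` is the transcendence
degree, so these elements are algebraically independent. -/
theorem linMap_injective (hR : Algebra.trdeg k R = s) (x : Fin n → R) (v : Fin s × Fin n → k)
    (h : (linMap x v).toRingHom.IsIntegral) : Function.Injective (linMap x v) := by
  let g : Fin s → R := fun i => ∑ l, v (i, l) • x l
  have halg : Algebra.IsAlgebraic (Algebra.adjoin k (Set.range g)) R := by
    refine ⟨fun y => IsIntegral.isAlgebraic ?_⟩
    obtain ⟨p, hp, hpy⟩ := h y
    let φ : MvPolynomial (Fin s) k →ₐ[k] Algebra.adjoin k (Set.range g) :=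
      MvPolynomial.aeval fun i => ⟨g i, Algebra.subset_adjoin ⟨i, rfl⟩⟩
    refine ⟨p.map φ.toRingHom, hp.map _, ?_⟩
    rw [Polynomial.eval₂_map, ← hpy]
    congr 1
    refine MvPolynomial.ringHom_ext (fun a => ?_) (fun i => ?_)
    · simp [φ, linMap]
    · simp [φ, linMap, g]
  have hb := Algebra.IsAlgebraic.isTranscendenceBasis_of_lift_le_trdeg_of_finite k g
    (by rw [hR]; simp)
  exact hb.1

end LinearNoetherNormalization

/-! ### Generic fibres of finite projections and omitted values of functions. -/

section GenericFibres

open Polynomial in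
theorem exists_expand_separable {k K : Type*} [Field k] [Field K] (ι : k →+* K) {f : K[X]}
    (hf : Irreducible f) : ∃ (q : ℕ) (g : K[X]), 0 < q ∧ Function.Injective (fun a : k => a ^ q) ∧
      g.Separable ∧ expand K q g = f := by
  obtain ⟨p, hp⟩ := CharP.exists k
  have hK : CharP K p := charP_of_injective_ringHom ι.injective p
  rcases Nat.eq_zero_or_pos p with rfl | hpos
  · have : CharZero K := CharP.charP_to_charZero K
    exact ⟨1, f, one_pos, fun a b h => by simpa using h, hf.separable, expand_one f⟩
  · obtain ⟨n, g, hg, hgf⟩ := exists_separable_of_irreducible p hf hpos.ne'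
    have : Fact p.Prime := ⟨(CharP.char_is_prime_or_zero k p).resolve_right hpos.ne'⟩
    exact ⟨p ^ n, g, pow_pos hpos n, iterateFrobenius_inj k p n, hg, hgf⟩

open Polynomial in
/-- Over a dense open set of parameters, an irreducible monic polynomial has at least as many
distinct roots as there are constants at which its value does not depend on the parameters. -/
theorem exists_card_le_card_roots {k : Type*} [Field k] [IsAlgClosed k] {σ : Type*}
    {K : Type*} [Field K] [Algebra (MvPolynomial σ k) K] [IsFractionRing (MvPolynomial σ k) K]
    {Q : (MvPolynomial σ k)[X]} (hQ : Q.Monic)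
    (hirr : Irreducible (Q.map (algebraMap (MvPolynomial σ k) K)))
    {α : σ →₀ ℕ} (hα : α ≠ 0) {i : ℕ} (hi : MvPolynomial.coeff α (Q.coeff i) ≠ 0)
    (M : Finset k) (hM : ∀ a ∈ M, ∃ c, Q.eval (MvPolynomial.C a) = MvPolynomial.C c) :
    ∃ h : MvPolynomial σ k, h ≠ 0 ∧ ∀ t, MvPolynomial.eval t h ≠ 0 →
      ∃ Y : Finset k, M.card ≤ Y.card ∧ ∀ y ∈ Y, (Q.map (MvPolynomial.eval t)).eval y = 0 := by
  have hinj : Function.Injective (algebraMap (MvPolynomial σ k) K) := IsFractionRing.injective (MvPolynomial σ k) K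
  obtain ⟨q, g, hq, hpow, hsep, hexp⟩ := exists_expand_separable
    ((algebraMap (MvPolynomial σ k) K).comp MvPolynomial.C) hirr
  let G : (MvPolynomial σ k)[X] := contract q Q
  have hGg : G.map (algebraMap (MvPolynomial σ k) K) = g := by
    ext j
    rw [coeff_map, coeff_contract hq.ne', ← coeff_map, ← hexp, coeff_expand_mul hq]
  have hGQ : expand (MvPolynomial σ k) q G = Q := by
    apply map_injective _ hinj
    rw [map_expand, hGg, hexp]
  have hG : G.Monic := by rwa [← monic_expand_iff hq, hGQ]
  obtain ⟨a, b, hab⟩ := hsep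
  obtain ⟨ba, hba, ha⟩ := IsLocalization.integerNormalization_spec (nonZeroDivisors (MvPolynomial σ k)) a
  obtain ⟨bb, hbb, hb⟩ := IsLocalization.integerNormalization_spec (nonZeroDivisors (MvPolynomial σ k)) b
  set U := IsLocalization.integerNormalization (nonZeroDivisors (MvPolynomial σ k)) a
  set V := IsLocalization.integerNormalization (nonZeroDivisors (MvPolynomial σ k)) b
  -- The Bézout identity for `g` and its derivative, cleared of denominators: `G` remains separable
  -- wherever `ba * bb` does not vanish.
  have hUV : C bb * U * G + C ba * V * derivative G = C (ba * bb) := by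
    apply map_injective _ hinj
    simp only [Polynomial.map_add, Polynomial.map_mul, map_C, ← derivative_map, hGg, ha, hb]
    have h1 : ∀ (c : MvPolynomial σ k) (p : K[X]), c • p = C (algebraMap (MvPolynomial σ k) K c) * p := fun c p => by
      rw [← smul_eq_C_mul, algebraMap_smul]
    rw [h1, h1, map_mul, C_mul]
    linear_combination C (algebraMap (MvPolynomial σ k) K ba) * C (algebraMap (MvPolynomial σ k) K bb) * hab
  have hcard : M.card ≤ G.natDegree := by
    -- The coefficient of the parameter monomial `α` in `G`, as a polynomial in the remaining
    -- variable.
    let gα : k[X] := ∑ j ∈ Finset.range (G.natDegree + 1),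
      C (MvPolynomial.coeff α (G.coeff j)) * X ^ j
    have hcoeff : ∀ j, gα.coeff j = MvPolynomial.coeff α (G.coeff j) := by
      intro j
      simp only [gα, finsetSum_coeff, coeff_C_mul_X_pow, Finset.sum_ite_eq, Finset.mem_range]
      split_ifs with h
      · rfl
      · rw [coeff_eq_zero_of_natDegree_lt (by omega), MvPolynomial.coeff_zero]
    have hgα : gα ≠ 0 := by
      intro h0
      rw [← hGQ, coeff_expand hq] at hi
      split_ifs at hi with h
      · rw [← hcoeff, h0, coeff_zero] at hi
        exact hi rfl
      · simp at hi
    have hdeg : gα.natDegree ≤ G.natDegree := by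
      rw [natDegree_le_iff_coeff_eq_zero]
      intro j hj
      rw [hcoeff, coeff_eq_zero_of_natDegree_lt hj, MvPolynomial.coeff_zero]
    have heval : ∀ b : k, gα.eval b = MvPolynomial.coeff α (G.eval (MvPolynomial.C b)) := by
      intro b
      rw [eval_eq_sum_range (p := G), MvPolynomial.coeff_sum]
      simp only [gα, eval_finsetSum, eval_mul, eval_C, eval_pow, eval_X]
      refine Finset.sum_congr rfl fun j _ => ?_
      rw [← map_pow, mul_comm _ (MvPolynomial.C _), MvPolynomial.coeff_C_mul, mul_comm]
    classical
    -- `Q(a) = G(a ^ q)` is constant in the parameters and `α ≠ 0`, so `a ^ q` is a root of `gα`.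
    have hsub : M.image (fun a => a ^ q) ⊆ gα.roots.toFinset := by
      intro z hz
      obtain ⟨a, ha, rfl⟩ := Finset.mem_image.mp hz
      rw [Multiset.mem_toFinset, mem_roots hgα, IsRoot, heval]
      obtain ⟨c, hc⟩ := hM a ha
      rw [← hGQ, expand_eval, ← map_pow] at hc
      rw [hc, MvPolynomial.coeff_C, if_neg hα.symm]
    rw [← Finset.card_image_of_injective M hpow]
    exact (Finset.card_le_card hsub).trans ((Multiset.toFinset_card_le _).trans
      ((card_roots' _).trans hdeg))
  refine ⟨ba * bb, mul_ne_zero (nonZeroDivisors.ne_zero hba) (nonZeroDivisors.ne_zero hbb),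
    fun t ht => ?_⟩
  let Gt := G.map (MvPolynomial.eval t)
  have hGt : Gt.Separable := by
    have h1 := congrArg (Polynomial.map (MvPolynomial.eval t)) hUV
    simp only [Polynomial.map_add, Polynomial.map_mul, map_C, ← derivative_map] at h1
    have hc : C (MvPolynomial.eval t (ba * bb))⁻¹ * C (MvPolynomial.eval t (ba * bb)) = 1 := by
      rw [← C_mul, inv_mul_cancel₀ ht, C_1]
    exact ⟨C (MvPolynomial.eval t (ba * bb))⁻¹ *
        (C (MvPolynomial.eval t bb) * U.map (MvPolynomial.eval t)),
      C (MvPolynomial.eval t (ba * bb))⁻¹ *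
        (C (MvPolynomial.eval t ba) * V.map (MvPolynomial.eval t)),
      by linear_combination C (MvPolynomial.eval t (ba * bb))⁻¹ * h1 + hc⟩
  classical
  -- Roots of the specialized `Q` are `q`-th roots of the roots of `Gt`; one chosen for each keeps
  -- them distinct.
  choose r hr using fun z : k => IsAlgClosed.exists_pow_nat_eq z hq
  refine ⟨Gt.roots.toFinset.image r, ?_, ?_⟩
  · rw [Finset.card_image_of_injective _ (fun z w h => by rw [← hr z, h, hr w]),
      Multiset.toFinset_card_of_nodup (nodup_roots hGt),
      splits_iff_card_roots.mp (IsAlgClosed.splits Gt), hG.natDegree_map]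
    exact hcard
  · intro y hy
    obtain ⟨z, hz, rfl⟩ := Finset.mem_image.mp hy
    rw [← hGQ, map_expand, expand_eval, hr]
    exact isRoot_of_mem_roots (Multiset.mem_toFinset.mp hz)

theorem evalPoint_linMap {k : Type*} [Field k] {n : ℕ} {Z : Set (AffSpace k n)} {x : AffSpace k n} (hx : x ∈ Z) {s : ℕ}
    (v : Fin s × Fin n → k) (i : Fin s) :
    evalPoint hx (linMap (fun j => Ideal.Quotient.mk (affIdeal Z) (MvPolynomial.X j)) v
      (MvPolynomial.X i)) = ∑ j, v (i, j) * x.coord j := by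
  simp only [linMap, MvPolynomial.aeval_X, map_sum, map_smul, evalPoint_mk, MvPolynomial.eval_X,
    smul_eq_mul]

variable {k : Type*} [Field k] [IsAlgClosed k] {n : ℕ}

/-- Lying over extends the kernel of `χ` to a maximal ideal of the coordinate ring, which is a point
of `Z` by the Nullstellensatz. -/
theorem exists_point_over {Z : Set (AffSpace k n)} (hZ : IsClosed Z) {C : Type*} [CommRing C]
    [Algebra k C] (φ : C →ₐ[k] coordRing Z) (hφ : φ.toRingHom.IsIntegral) (χ : C →ₐ[k] k)
    (h : ∀ c, φ c = 0 → χ c = 0) :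
    ∃ (x : AffSpace k n) (hx : x ∈ Z), ∀ c, evalPoint hx (φ c) = χ c := by
  have hmax : (RingHom.ker χ).IsMaximal := RingHom.ker_isMaximal_of_surjective _
    fun a => ⟨algebraMap k _ a, χ.commutes a⟩
  obtain ⟨m, hm, hcomap⟩ : ∃ m : Ideal (coordRing Z), m.IsMaximal ∧
      m.comap φ.toRingHom = RingHom.ker χ := by
    algebraize [φ.toRingHom]
    exact Ideal.exists_ideal_over_maximal_of_isIntegral (RingHom.ker χ) fun c hc => h c hc
  have hm' : (m.comap (Ideal.Quotient.mk (affIdeal Z))).IsMaximal :=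
    Ideal.comap_isMaximal_of_surjective _ Ideal.Quotient.mk_surjective
  obtain ⟨x, hx⟩ : ∃ x : AffSpace k n, m.comap (Ideal.Quotient.mk (affIdeal Z)) =
      MvPolynomial.vanishingIdeal k {x.coord} :=
    MvPolynomial.isMaximal_iff_eq_vanishingIdeal_singleton.mp hm'
  have hxZ : x ∈ Z := by
    rw [← affZeros_affIdeal hZ]
    intro f hf
    have : f ∈ m.comap (Ideal.Quotient.mk (affIdeal Z)) := by
      rw [Ideal.mem_comap, Ideal.Quotient.eq_zero_iff_mem.mpr hf]
      exact m.zero_mem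
    rw [hx] at this
    exact this x rfl
  refine ⟨x, hxZ, fun c => ?_⟩
  have h1 : c - algebraMap k C (χ c) ∈ RingHom.ker χ := by
    rw [RingHom.mem_ker, map_sub, AlgHom.commutes]
    simp
  rw [← hcomap, Ideal.mem_comap] at h1
  obtain ⟨f, hf⟩ := Ideal.Quotient.mk_surjective (φ.toRingHom (c - algebraMap k C (χ c)))
  rw [← hf, ← Ideal.mem_comap, hx] at h1
  have h2 : evalPoint hxZ (φ (c - algebraMap k C (χ c))) = 0 := by
    change evalPoint hxZ (φ.toRingHom (c - algebraMap k C (χ c))) = 0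
    rw [← hf, evalPoint_mk]
    exact h1 x rfl
  rw [map_sub, map_sub, AlgHom.commutes, AlgHom.commutes, sub_eq_zero] at h2
  exact h2

theorem MvPolynomial.exists_eq_C_of_forall_eval_ne_zero {σ : Type*} [Finite σ] {b : MvPolynomial σ k}
    (hb : ∀ t, MvPolynomial.eval t b ≠ 0) : ∃ c, b = MvPolynomial.C c := by
  have : IsUnit b := by
    by_contra hu
    obtain ⟨m, hm, hbm⟩ := exists_max_ideal_of_mem_nonunits hu
    obtain ⟨t, rfl⟩ := MvPolynomial.isMaximal_iff_eq_vanishingIdeal_singleton.mp hm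
    exact hb t (hbm t rfl)
  obtain ⟨c, -, hc⟩ := MvPolynomial.isUnit_iff_eq_C_of_isReduced.mp this
  exact ⟨c, hc⟩

/-- A generic linear projection of an irreducible affine variety of dimension `s` to `𝔸ˢ` is finite,
and its general fibre has as many points as the degree says. -/
theorem AffIrredDegree.exists_linMap {Z : Set (AffSpace k n)} (hZ : IsClosed Z)
    (hirr : IsIrreducible Z) {d : ℕ} (h : AffIrredDegree Z d) :
    ∃ (s : ℕ) (v : Fin s × Fin n → k) (P : MvPolynomial (Fin s) k), P ≠ 0 ∧
      (linMap (fun j => Ideal.Quotient.mk (affIdeal Z) (MvPolynomial.X j)) v).toRingHom.IsIntegral ∧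
      Function.Injective (linMap (fun j => Ideal.Quotient.mk (affIdeal Z) (MvPolynomial.X j)) v) ∧
      ∀ t, MvPolynomial.eval t P ≠ 0 →
        (Z ∩ {x | ∀ i, ∑ j, v (i, j) * x.coord j = t i}).encard = d := by
  have : Infinite k := IsAlgClosed.instInfinite
  have := affIdeal_isPrime hirr
  obtain ⟨s, hs, P, hP, hA⟩ := h
  have htr := trdeg_coordRing_eq hZ hirr (zariskiDim_eq_natCast_iff.mp hs)
  let x : Fin n → coordRing Z := fun j => Ideal.Quotient.mk (affIdeal Z) (MvPolynomial.X j)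
  have hx : Function.Surjective (MvPolynomial.aeval (R := k) x) := by
    have : MvPolynomial.aeval x = Ideal.Quotient.mkₐ k (affIdeal Z) := by
      ext j; simp [x]
    rw [this]
    exact Ideal.Quotient.mkₐ_surjective _ _
  obtain ⟨A, hA0, hint⟩ := exists_linMap_isIntegral htr x hx hP
  -- The linear parts are now fixed and only the constant terms `-t i` vary. At `t i = -A (i, 0)`
  -- this returns the value of `P` at `A`, so `P'` is nonzero.
  let P' : MvPolynomial (Fin s) k := MvPolynomial.aeval (fun ij : Fin s × Fin (n + 1) =>
    Fin.cases (-MvPolynomial.X ij.1) (fun j => MvPolynomial.C (A (ij.1, j.succ))) ij.2) P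
  have hP' : ∀ t, MvPolynomial.eval t P' = MvPolynomial.eval (fun ij : Fin s × Fin (n + 1) =>
      Fin.cases (-t ij.1) (fun j => A (ij.1, j.succ)) ij.2) P := by
    intro t
    have : (MvPolynomial.aeval t).comp (MvPolynomial.aeval (fun ij : Fin s × Fin (n + 1) =>
        Fin.cases (-MvPolynomial.X ij.1) (fun j => MvPolynomial.C (A (ij.1, j.succ))) ij.2)) =
        (MvPolynomial.aeval (fun ij : Fin s × Fin (n + 1) =>
          Fin.cases (-t ij.1) (fun j => A (ij.1, j.succ)) ij.2) :
            MvPolynomial (Fin s × Fin (n + 1)) k →ₐ[k] k) := by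
      ext ⟨i, j⟩
      refine Fin.cases ?_ (fun j => ?_) j <;> simp
    exact DFunLike.congr_fun this P
  refine ⟨s, fun il => A (il.1, il.2.succ), P', ?_, hint, linMap_injective htr x _ hint, ?_⟩
  · intro h0
    have h1 := hP' (fun i => -A (i, 0))
    rw [h0, map_zero] at h1
    refine hA0 ?_
    rw [h1]
    congr 2
    funext ⟨i, j⟩
    refine Fin.cases ?_ (fun j => ?_) j <;> simp
  · intro t ht
    rw [hP'] at ht
    let A' : Fin s → Fin (n + 1) → k := fun i => Fin.cons (-t i) fun j => A (i, j.succ)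
    have hA' : (fun ij : Fin s × Fin (n + 1) => A' ij.1 ij.2) = fun ij =>
        Fin.cases (-t ij.1) (fun j => A (ij.1, j.succ)) ij.2 := by
      funext ⟨i, j⟩
      rfl
    have h2 : (Z ∩ affLinear A').encard = d := hA A' (by rw [hA']; exact ht)
    have h3 : affLinear A' =
        {x : AffSpace k n | ∀ i, ∑ j, A (i, j.succ) * x.coord j = t i} := by
      ext y
      refine forall_congr' fun i => ?_
      change -t i + ∑ j : Fin n, A (i, j.succ) * y.coord j = 0 ↔ _
      rw [neg_add_eq_zero, eq_comm]
    rw [← h2, h3]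

theorem AffIrredDegree.pos {Z : Set (AffSpace k n)} (hZ : IsClosed Z)
    (hirr : IsIrreducible Z) {d : ℕ} (h : AffIrredDegree Z d) : 0 < d := by
  have : Infinite k := IsAlgClosed.instInfinite
  obtain ⟨s, v, P, hP, hint, hinj, hcard⟩ := h.exists_linMap hZ hirr
  obtain ⟨t, ht⟩ := MvPolynomial.exists_eval_ne_zero hP
  obtain ⟨x, hx, hxt⟩ := exists_point_over hZ _ hint (MvPolynomial.aeval t) fun c hc => by
    rw [(map_eq_zero_iff _ hinj).mp hc, map_zero]
  have hne : (Z ∩ {x | ∀ i, ∑ j, v (i, j) * x.coord j = t i}).Nonempty := by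
    refine ⟨x, hx, fun i => ?_⟩
    have := hxt (MvPolynomial.X i)
    rwa [evalPoint_linMap, MvPolynomial.aeval_X] at this
  rw [← Set.encard_ne_zero, hcard t ht] at hne
  exact Nat.pos_of_ne_zero (by exact_mod_cast hne)

theorem exists_eq_algebraMap_of_isIntegral {R : Type*} [CommRing R] [IsDomain R] [Algebra k R] {y : R}
    (hy : IsIntegral k y) : ∃ a, y = algebraMap k R a := by
  obtain ⟨a, ha⟩ := minpoly.mem_range_of_degree_eq_one k y
    (IsAlgClosed.degree_eq_one_of_irreducible k (minpoly.irreducible hy))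
  exact ⟨a, ha.symm⟩

/-- A nonconstant function on an irreducible affine variety omits at most as many values as the
degree of the variety says. -/
theorem AffIrredDegree.card_le_of_forall_ne {Z : Set (AffSpace k n)} (hZ : IsClosed Z)
    (hirr : IsIrreducible Z) {d : ℕ} (h : AffIrredDegree Z d) (f : MvPolynomial (Fin n) k)
    (hf : ¬ ∃ a, ∀ x ∈ Z, MvPolynomial.eval x.coord f = a) (M : Finset k)
    (hM : ∀ a ∈ M, ∀ x ∈ Z, MvPolynomial.eval x.coord f ≠ a) : M.card ≤ d := by
  have : Infinite k := IsAlgClosed.instInfinite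
  have := affIdeal_isPrime hirr
  obtain ⟨s, v, P, hP, hint, hinj, hcard⟩ := h.exists_linMap hZ hirr
  set φ := linMap (fun j => Ideal.Quotient.mk (affIdeal Z) (MvPolynomial.X j)) v with hφ
  let y : coordRing Z := Ideal.Quotient.mk (affIdeal Z) f
  algebraize [φ.toRingHom]
  have hfaith : FaithfulSMul (MvPolynomial (Fin s) k) (coordRing Z) :=
    (faithfulSMul_iff_algebraMap_injective _ _).mpr hinj
  have htower : IsScalarTower k (MvPolynomial (Fin s) k) (coordRing Z) := .of_algHom φ
  have hy : IsIntegral (MvPolynomial (Fin s) k) y := Algebra.IsIntegral.isIntegral y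
  set Q := minpoly (MvPolynomial (Fin s) k) y with hQ
  have hQm : Q.Monic := minpoly.monic hy
  have hQ0 : Polynomial.aeval y Q = 0 := minpoly.aeval _ _
  -- Every root of the specialized minimal polynomial is a value of `f` at a point of the fibre over
  -- `t`.
  have hlift : ∀ (t : Fin s → k) (b : k), (Q.map (MvPolynomial.eval t)).eval b = 0 →
      ∃ x ∈ Z, (∀ i, ∑ j, v (i, j) * x.coord j = t i) ∧ MvPolynomial.eval x.coord f = b := by
    intro t b hb
    let φ' : Polynomial (MvPolynomial (Fin s) k) →ₐ[k] coordRing Z :=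
      (Polynomial.aeval y).restrictScalars k
    let χ : Polynomial (MvPolynomial (Fin s) k) →ₐ[k] k :=
      Polynomial.eval₂AlgHom (MvPolynomial.aeval t) b fun _ => Commute.all _ _
    have hχ : ∀ c, χ c = (c.map (MvPolynomial.eval t)).eval b := fun c => by
      rw [Polynomial.eval_map]
      rfl
    have hφ'C : ∀ c, φ' (Polynomial.C c) = φ c := fun c => Polynomial.aeval_C _ _
    have hint' : φ'.toRingHom.IsIntegral := by
      intro z
      obtain ⟨p, hp, hpz⟩ := hint z
      refine ⟨p.map Polynomial.C, hp.map _, ?_⟩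
      rw [Polynomial.eval₂_map, ← hpz]
      congr 1
      exact RingHom.ext hφ'C
    obtain ⟨x, hx, hxt⟩ := exists_point_over hZ φ' hint' χ fun c hc => by
      -- The polynomial ring is integrally closed, so `Q` divides every polynomial that annihilates
      -- `y`.
      obtain ⟨e, rfl⟩ := minpoly.isIntegrallyClosed_dvd hy (p := c) hc
      rw [hχ, Polynomial.map_mul, Polynomial.eval_mul, ← hQ, hb, zero_mul]
    refine ⟨x, hx, fun i => ?_, ?_⟩
    · have := hxt (Polynomial.C (MvPolynomial.X i))
      rw [hφ'C, hφ, evalPoint_linMap, hχ] at this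
      simpa using this
    · have := hxt Polynomial.X
      rw [hχ, show φ' Polynomial.X = y from Polynomial.aeval_X _, evalPoint_mk] at this
      simpa using this
  -- If all coefficients of `Q` were scalars, `y` would be integral over the algebraically closed
  -- field `k`, hence constant on `Z`.
  obtain ⟨α, hα, i, hi⟩ : ∃ α : Fin s →₀ ℕ, α ≠ 0 ∧ ∃ i, MvPolynomial.coeff α (Q.coeff i) ≠ 0 := by
    by_contra! hc
    have hQC : (Q.map MvPolynomial.constantCoeff).map MvPolynomial.C = Q := by
      ext i β
      rw [Polynomial.coeff_map, Polynomial.coeff_map, MvPolynomial.coeff_C]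
      split_ifs with hβ
      · rw [← hβ]
        rfl
      · rw [hc β (Ne.symm hβ)]
    have hyk : IsIntegral k y := by
      refine ⟨Q.map MvPolynomial.constantCoeff, hQm.map _, ?_⟩
      have h1 := hQ0
      rw [← hQC, Polynomial.aeval_def, Polynomial.eval₂_map] at h1
      rw [← h1]
      congr 1
      exact RingHom.ext fun c => (φ.commutes c).symm
    obtain ⟨a, ha⟩ := exists_eq_algebraMap_of_isIntegral hyk
    refine hf ⟨a, fun x hx => ?_⟩
    rw [← evalPoint_mk hx]
    change evalPoint hx y = a
    rw [ha, AlgHom.commutes]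
    rfl
  have hMc : ∀ a ∈ M, ∃ c, Q.eval (MvPolynomial.C a) = MvPolynomial.C c := by
    intro a ha
    refine MvPolynomial.exists_eq_C_of_forall_eval_ne_zero fun t ht => ?_
    obtain ⟨x, hx, -, hxa⟩ := hlift t a (by
      rw [← ht, Polynomial.eval_map, Polynomial.eval, Polynomial.hom_eval₂]
      simp)
    exact hM a ha x hx hxa
  have hirrK : Irreducible (Q.map (algebraMap (MvPolynomial (Fin s) k)
      (FractionRing (MvPolynomial (Fin s) k)))) :=
    hQm.irreducible_iff_irreducible_map_fraction_map.mp (minpoly.irreducible hy)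
  obtain ⟨g, hg, hroots⟩ := exists_card_le_card_roots hQm hirrK hα hi M hMc
  -- A parameter general for both counts: the fibre has `d` points, and `f` takes at least `M.card`
  -- values on it.
  obtain ⟨t, ht⟩ := MvPolynomial.exists_eval_ne_zero (mul_ne_zero hP hg)
  rw [map_mul, mul_ne_zero_iff] at ht
  obtain ⟨Y, hMY, hY⟩ := hroots t ht.2
  have hsub : (Y : Set k) ⊆ (fun x : AffSpace k n => MvPolynomial.eval x.coord f) ''
      (Z ∩ {x | ∀ i, ∑ j, v (i, j) * x.coord j = t i}) := by
    intro b hb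
    obtain ⟨x, hx, hxt, hxb⟩ := hlift t b (hY b hb)
    exact ⟨x, ⟨hx, hxt⟩, hxb⟩
  have h2 := (Set.encard_le_encard hsub).trans (Set.encard_image_le _ _)
  rw [hcard t ht.1, Set.encard_coe_eq_coe_finsetCard] at h2
  exact hMY.trans (by exact_mod_cast h2)

end GenericFibres

/-! ### Union bounds and counting for random coefficients. -/

section Probability

variable {k : Type*} {m : ℕ}

theorem coeffProb_le_add {S : Finset k} {A B E : (Fin m → k) → Prop}
    (h : ∀ c, E c → A c ∨ B c) : coeffProb S m E ≤ coeffProb S m A + coeffProb S m B := by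
  classical
  unfold coeffProb
  rw [← add_div]
  gcongr
  refine le_trans ?_ (Nat.cast_le.mpr (Finset.card_union_le _ _)) |>.trans_eq (Nat.cast_add _ _)
  rw [← Finset.filter_or]
  gcongr
  exact h _

theorem coeffProb_le_sum {ι : Type*} {S : Finset k} {C : Finset ι} {B : ι → (Fin m → k) → Prop}
    {E : (Fin m → k) → Prop} (h : ∀ c, E c → ∃ Z ∈ C, B Z c) :
    coeffProb S m E ≤ ∑ Z ∈ C, coeffProb S m (B Z) := by
  classical
  induction C using Finset.induction_on generalizing E with
  | empty =>
    have hE : E = fun _ => False := by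
      funext c
      simpa using h c
    simp [hE, coeffProb]
  | insert Z C hZ ih =>
    rw [Finset.sum_insert hZ]
    refine (coeffProb_le_add (A := B Z) (B := fun c => ∃ Z ∈ C, B Z c) fun c hc => ?_).trans
      (by gcongr; exact ih fun c hc => hc)
    simpa using h c hc

theorem one_sub_coeffProb_le {S : Finset k} (hS : S.Nonempty) {B E : (Fin m → k) → Prop}
    (h : ∀ c, ¬ B c → E c) : 1 - coeffProb S m B ≤ coeffProb S m E := by
  have h1 : coeffProb S m (fun _ => True) = 1 := by
    have : (S.card : ℝ) ≠ 0 := by exact_mod_cast hS.card_ne_zero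
    simp [coeffProb, this]
  rw [sub_le_iff_le_add, ← h1]
  exact coeffProb_le_add fun c _ => or_iff_not_imp_right.mpr (h c)

/-- If, whatever the other coefficients are, at most `M` values of the `i`-th coefficient are in an
event, then the event has probability at most `M / |S|`. -/
theorem coeffProb_le_div {S : Finset k} (hS : S.Nonempty) (i : Fin (m + 1))
    {E : (Fin (m + 1) → k) → Prop} {M : ℕ}
    (h : ∀ (a : Fin m → k) (T : Finset k),
      (∀ b ∈ T, b ∈ S ∧ E (i.insertNth (α := fun _ => k) b a)) → T.card ≤ M) :
    coeffProb S (m + 1) E ≤ (M : ℝ) / S.card := by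
  classical
  unfold coeffProb
  set F := (Fintype.piFinset fun _ : Fin (m + 1) => S).filter E with hF
  have h1 : F.card ≤ M * (F.image i.removeNth).card := by
    refine Finset.card_le_mul_card_image F M fun a _ => ?_
    rw [← Finset.card_image_of_injOn (f := fun c : Fin (m + 1) → k => c i)]
    · refine h a _ fun b hb => ?_
      obtain ⟨c, hc, rfl⟩ := Finset.mem_image.mp hb
      obtain ⟨hcF, rfl⟩ := Finset.mem_filter.mp hc
      obtain ⟨hcS, hcE⟩ := Finset.mem_filter.mp hcF
      refine ⟨Fintype.mem_piFinset.mp hcS i, ?_⟩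
      rwa [Fin.insertNth_self_removeNth]
    · intro c hc c' hc' hcc
      have e := (Finset.mem_filter.mp hc).2
      have e' := (Finset.mem_filter.mp hc').2
      rw [← Fin.insertNth_self_removeNth i c, ← Fin.insertNth_self_removeNth i c', e, e']
      congr 1
  have h2 : (F.image i.removeNth).card ≤ S.card ^ m := by
    refine (Finset.card_le_card (t := Fintype.piFinset fun _ : Fin m => S) ?_).trans_eq (by simp)
    intro a ha
    obtain ⟨c, hc, rfl⟩ := Finset.mem_image.mp ha
    exact Fintype.mem_piFinset.mpr fun j =>
      Fintype.mem_piFinset.mp (Finset.mem_filter.mp hc).1 (i.succAbove j)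
  have h3 : (F.card : ℝ) ≤ M * (S.card : ℝ) ^ m := by
    exact_mod_cast h1.trans (Nat.mul_le_mul_left M h2)
  have hpos : (0 : ℝ) < S.card := by exact_mod_cast hS.card_pos
  rw [div_le_div_iff₀ (pow_pos hpos _) hpos, pow_succ, ← mul_assoc]
  gcongr

/-- Once the other coefficients are fixed, the equation determines the `i`-th one. -/
theorem coeffProb_sum_mul_eq_zero_le [Field k] {S : Finset k} (hS : S.Nonempty)
    {w : Fin (m + 1) → k} {i : Fin (m + 1)} (hi : w i ≠ 0) :
    coeffProb S (m + 1) (fun c => ∑ j, c j * w j = 0) ≤ 1 / S.card := by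
  refine (coeffProb_le_div hS i (M := 1) fun a T hT => ?_).trans_eq (by simp)
  refine Finset.card_le_one.mpr fun b hb b' hb' => mul_right_cancel₀ hi ?_
  have h1 := (hT b hb).2
  have h2 := (hT b' hb').2
  simp only [Fin.sum_univ_succAbove _ i, Fin.insertNth_apply_same,
    Fin.insertNth_apply_succAbove] at h1 h2
  exact add_right_cancel (h1.trans h2.symm)

theorem one_sub_sum_div_le_coeffProb {ι : Type*} {S : Finset k} (hS : S.Nonempty) {C : Finset ι}
    {B : ι → (Fin m → k) → Prop} {E : (Fin m → k) → Prop} {e : ι → ℝ}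
    (hB : ∀ Z ∈ C, coeffProb S m (B Z) ≤ e Z / S.card)
    (h : ∀ c, (∀ Z ∈ C, ¬ B Z c) → E c) : 1 - (∑ Z ∈ C, e Z) / S.card ≤ coeffProb S m E := by
  have h1 := one_sub_coeffProb_le hS (B := fun c => ∃ Z ∈ C, B Z c) (E := E)
    fun c hc => h c (by simpa using hc)
  have h2 := coeffProb_le_sum (S := S) (C := C) (B := B) (E := fun c => ∃ Z ∈ C, B Z c)
    fun c hc => hc
  have h3 := h2.trans (Finset.sum_le_sum hB)
  rw [← Finset.sum_div] at h3
  linarith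

end Probability

/-! ### Random hyperplanes against a single component. -/

section RandomHyperplanes

variable {k : Type*} [Field k] {n : ℕ}

theorem card_filter_le_val (m : ℕ) :
    (Finset.univ.filter fun j : Fin n => m ≤ j).card = n - m := by
  have := Finset.card_filter_add_card_filter_not (s := (Finset.univ : Finset (Fin n)))
    (fun j => (j : ℕ) < m)
  simp only [Fin.card_filter_val_lt, not_lt, Finset.card_univ, Fintype.card_fin] at this
  omega

theorem exists_castLE_of_notMem {m : ℕ} (hm : m ≤ n) {j : Fin n}
    (hj : j ∉ Finset.univ.filter fun j : Fin n => m ≤ j) : ∃ i : Fin m, j = Fin.castLE hm i := by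
  simp only [Finset.mem_filter, Finset.mem_univ, true_and, not_le] at hj
  exact ⟨⟨j, hj⟩, rfl⟩

theorem exists_projHyperplane_eq_projZeros {r : ℕ} (c : Fin (n - r + 1) → k) :
    ∃ f : MvPolynomial (Fin (n + 1)) k, f.IsHomogeneous 1 ∧
      projHyperplane (r := r) c = projZeros {f} := by
  have hf : (∑ j, MvPolynomial.C (c j) * MvPolynomial.X (Fin.castLE (by omega) j) :
      MvPolynomial (Fin (n + 1)) k).IsHomogeneous 1 :=
    MvPolynomial.IsHomogeneous.sum _ _ _ fun j _ => MvPolynomial.isHomogeneous_C_mul_X _ _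
  refine ⟨_, hf, ?_⟩
  ext p
  constructor
  · rintro hp _ rfl -
    simpa [projHyperplane] using hp
  · intro hp
    simpa [projHyperplane] using hp _ rfl ⟨1, hf⟩

theorem affHyperplane_eq_affZeros {r : ℕ} (c : Fin (min n (n - r + 1) + 1) → k) :
    affHyperplane (r := r) c = affZeros {MvPolynomial.C (c 0) +
      ∑ j, MvPolynomial.C (c j.succ) * MvPolynomial.X (Fin.castLE (by omega) j)} := by
  ext p
  simp [affHyperplane, affZeros]

/-- At a single point of `Z` the constant term has coefficient 1, so the condition is never trivial.
This is all that the case `r = 0` needs. -/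
theorem coeffProb_subset_affHyperplane_le {r : ℕ} {S : Finset k} (hS : S.Nonempty)
    {Z : Set (AffSpace k n)} (hne : Z.Nonempty) :
    coeffProb S (min n (n - r + 1) + 1) (fun c => Z ⊆ affHyperplane (r := r) c) ≤ 1 / S.card := by
  obtain ⟨p, hp⟩ := hne
  have h1 := coeffProb_sum_mul_eq_zero_le (m := min n (n - r + 1)) hS
    (w := Fin.cons 1 fun j => p.coord (Fin.castLE (by omega) j)) (i := 0) one_ne_zero
  refine le_trans ?_ h1
  have h2 := coeffProb_le_sum (S := S) (C := {()}) (E := fun c => Z ⊆ affHyperplane (r := r) c)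
    (B := fun _ c => ∑ j, c j * (Fin.cons 1 fun j => p.coord (Fin.castLE (by omega) j) :
      Fin (min n (n - r + 1) + 1) → k) j = 0)
    fun c hc => ⟨(), by simp, by simpa [Fin.sum_univ_succ, affHyperplane] using hc hp⟩
  simpa using h2

variable [IsAlgClosed k]

theorem exists_coord_ne {Z : Set (AffSpace k n)} (hZ : IsClosed Z) (hirr : IsIrreducible Z) {s : ℕ}
    (hs : (s : WithBot ℕ∞) ≤ topologicalKrullDim Z) (J : Finset (Fin n)) (hJ : J.card < s) :
    ∃ j ∉ J, ∃ x ∈ Z, ∃ y ∈ Z, x.coord j ≠ y.coord j := by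
  have := affIdeal_isPrime hirr
  by_contra! hc
  obtain ⟨t, ht, htr, -⟩ := exists_topologicalKrullDim_eq_trdeg_eq_height hZ hirr
  obtain ⟨y, hy⟩ := hirr.nonempty
  have hle := trdeg_coordRing_le_of_coord_const (Z := Z) J
    fun j hj => ⟨y.coord j, fun x hx => hc j hj x hx y hy⟩
  rw [htr] at hle
  rw [ht] at hs
  have h1 : t ≤ J.card := by exact_mod_cast hle
  have h2 : s ≤ t := by exact_mod_cast hs
  omega

theorem le_of_natCast_le_topologicalKrullDim {Z : Set (AffSpace k n)} (hZ : IsClosed Z)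
    (hirr : IsIrreducible Z) {s : ℕ} (hs : (s : WithBot ℕ∞) ≤ topologicalKrullDim Z) : s ≤ n := by
  by_contra! h
  obtain ⟨j, hj, -⟩ := exists_coord_ne hZ hirr hs Finset.univ (by simpa using h)
  exact hj (Finset.mem_univ j)

/-- The cone has dimension at least `r + 1` and only `r` coordinates are left out, so one of the
first `n - r + 1` is nonconstant on the cone. -/
theorem exists_coord_castLE_ne_zero {r : ℕ} {Z : Set (ProjSpace k n)} (hZ : IsClosed Z)
    (hirr : IsIrreducible Z) (hr : (r : WithBot ℕ∞) ≤ topologicalKrullDim Z) :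
    ∃ p ∈ Z, ∃ i : Fin (n - r + 1), p.coord (Fin.castLE (by omega) i) ≠ 0 := by
  have : Infinite k := IsAlgClosed.instInfinite
  have hr' := (natCast_le_topologicalKrullDim_cone_iff hZ r).mpr hr
  have hrn := le_of_natCast_le_topologicalKrullDim (isClosed_cone hZ) (isIrreducible_cone hirr) hr'
  obtain ⟨j, hj, x, hx, y, hy, hxy⟩ := exists_coord_ne (isClosed_cone hZ) (isIrreducible_cone hirr)
    hr' (Finset.univ.filter fun j : Fin (n + 1) => n - r + 1 ≤ j)
    (by rw [card_filter_le_val]; omega)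
  obtain ⟨i, rfl⟩ := exists_castLE_of_notMem (by omega) hj
  obtain ⟨z, hz, hz0⟩ : ∃ z ∈ cone Z, z.coord (Fin.castLE (by omega) i) ≠ 0 := by
    by_cases h : x.coord (Fin.castLE (by omega) i) = 0
    · exact ⟨y, hy, fun h' => hxy (h.trans h'.symm)⟩
    · exact ⟨x, hx, h⟩
  have hz1 : z.coord ≠ 0 := fun h => hz0 (congrFun h _)
  obtain ⟨a, ha, hcoord⟩ := exists_smul_eq_coord_projPoint z.coord hz1
  refine ⟨projPoint z.coord hz1, hz hz1, i, ?_⟩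
  rw [hcoord]
  exact mul_ne_zero ha hz0

theorem zariskiDim_inter_projHyperplane {r : ℕ} {V : Set (ProjSpace k n)} (hV : IsClosed V)
    (hr : topologicalKrullDim V = (r : WithBot ℕ∞)) {c : Fin (n - r + 1) → k}
    (h : ∀ Z ∈ componentsOf V, topologicalKrullDim Z = (r : WithBot ℕ∞) →
      ¬ Z ⊆ projHyperplane (r := r) c) :
    zariskiDim (V ∩ projHyperplane (r := r) c) = (((r : ℤ) - 1 : ℤ) : WithTop ℤ) := by
  obtain ⟨f, hf, hcf⟩ := exists_projHyperplane_eq_projZeros (n := n) c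
  rw [hcf] at h ⊢
  refine zariskiDim_eq_sub_one (not_le_topologicalKrullDim_inter hV (isClosed_projZeros _) hr h) ?_
  rintro s rfl
  exact natCast_le_topologicalKrullDim_inter_projZeros hV hf hr.ge

theorem coeffProb_subset_projHyperplane_le {r : ℕ} {S : Finset k} (hS : S.Nonempty)
    {Z : Set (ProjSpace k n)} (hZ : IsClosed Z) (hirr : IsIrreducible Z)
    (hr : (r : WithBot ℕ∞) ≤ topologicalKrullDim Z) :
    coeffProb S (n - r + 1) (fun c => Z ⊆ projHyperplane (r := r) c) ≤ 1 / S.card := by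
  obtain ⟨p, hp, i, hi⟩ := exists_coord_castLE_ne_zero hZ hirr hr
  have h1 := coeffProb_sum_mul_eq_zero_le hS
    (w := fun j : Fin (n - r + 1) => p.coord (Fin.castLE (by omega) j)) hi
  refine le_trans ?_ h1
  have h2 := coeffProb_le_sum (S := S) (C := {()}) (E := fun c => Z ⊆ projHyperplane (r := r) c)
    (B := fun _ (c : Fin (n - r + 1) → k) => ∑ j, c j * p.coord (Fin.castLE (by omega) j) = 0)
    fun c hc => ⟨(), by simp, hc hp⟩
  simpa using h2

/-- An affine hyperplane can miss a component altogether, so the lower bound needs a common point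
when `r ≠ 0`. -/
theorem zariskiDim_inter_affHyperplane {r : ℕ} {V : Set (AffSpace k n)} (hV : IsClosed V)
    (hr : topologicalKrullDim V = (r : WithBot ℕ∞)) {c : Fin (min n (n - r + 1) + 1) → k}
    (h : ∀ Z ∈ componentsOf V, topologicalKrullDim Z = (r : WithBot ℕ∞) →
      ¬ Z ⊆ affHyperplane (r := r) c ∧ (r ≠ 0 → (Z ∩ affHyperplane (r := r) c).Nonempty)) :
    zariskiDim (V ∩ affHyperplane (r := r) c) = (((r : ℤ) - 1 : ℤ) : WithTop ℤ) := by
  have hcf := affHyperplane_eq_affZeros (n := n) c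
  set f := MvPolynomial.C (c 0) +
      ∑ j, MvPolynomial.C (c j.succ) * MvPolynomial.X (R := k) (Fin.castLE _ j)
  rw [hcf] at h ⊢
  refine zariskiDim_eq_sub_one (not_le_topologicalKrullDim_inter hV (isClosed_affZeros _) hr
    fun Z hZ hZr => (h Z hZ hZr).1) ?_
  rintro s rfl
  obtain ⟨Z, hZ, hZr⟩ := exists_mem_componentsOf_topologicalKrullDim_eq hV hr
  obtain ⟨x, hx, hxf⟩ := (h Z hZ hZr).2 (by omega)
  exact (le_topologicalKrullDim_inter_affZeros (isClosed_of_mem_componentsOf hV hZ) hZ.1.1 hx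
    (hxf f rfl) hZr.ge).trans (topologicalKrullDim_mono (Set.inter_subset_inter_left _ hZ.1.2))

theorem coeffProb_subset_or_disjoint_affHyperplane_le {r : ℕ} (hr0 : r ≠ 0) {S : Finset k}
    (hS : S.Nonempty) {Z : Set (AffSpace k n)} (hZ : IsClosed Z) (hirr : IsIrreducible Z)
    (hr : (r : WithBot ℕ∞) ≤ topologicalKrullDim Z) {d : ℕ} (hd : AffIrredDegree Z d) :
    coeffProb S (min n (n - r + 1) + 1) (fun c => Z ⊆ affHyperplane (r := r) c ∨
      ¬ (Z ∩ affHyperplane (r := r) c).Nonempty) ≤ 2 * d / S.card := by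
  have hrn := le_of_natCast_le_topologicalKrullDim hZ hirr hr
  have hm : min n (n - r + 1) ≤ n := min_le_left _ _
  -- Here `m = n - r + 1`, since `1 ≤ r ≤ n`; only `r - 1` coordinates are left out, fewer than the
  -- dimension.
  obtain ⟨j, hj, p, hp, q, hq, hpq⟩ := exists_coord_ne hZ hirr hr
    (Finset.univ.filter fun j : Fin n => min n (n - r + 1) ≤ j)
    (by rw [card_filter_le_val]; omega)
  obtain ⟨i, rfl⟩ := exists_castLE_of_notMem hm hj
  let g : (Fin (min n (n - r + 1)) → k) → MvPolynomial (Fin n) k := fun a =>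
    ∑ j, MvPolynomial.C (a j) * MvPolynomial.X (Fin.castLE hm j)
  have hg : ∀ a x, MvPolynomial.eval x (g a) = ∑ j, a j * x (Fin.castLE hm j) := fun a x => by
    simp [g]
  have hH : ∀ (c : Fin (min n (n - r + 1) + 1) → k) (x : AffSpace k n),
      x ∈ affHyperplane (r := r) c ↔ c 0 + MvPolynomial.eval x.coord (g (Fin.tail c)) = 0 := by
    intro c x
    rw [hg]
    rfl
  let w : Fin (min n (n - r + 1) + 1) → k :=
    Fin.cons 0 fun j => p.coord (Fin.castLE hm j) - q.coord (Fin.castLE hm j)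
  have hw : ∀ c, ∑ j, c j * w j = 0 ↔ MvPolynomial.eval p.coord (g (Fin.tail c)) =
      MvPolynomial.eval q.coord (g (Fin.tail c)) := by
    intro c
    rw [hg, hg, ← sub_eq_zero (a := ∑ j, Fin.tail c j * _), ← Finset.sum_sub_distrib,
      Fin.sum_univ_succ]
    simp [w, mul_sub, Fin.tail]
  have h1 : coeffProb S _ (fun c => ∑ j, c j * w j = 0) ≤ 1 / S.card :=
    coeffProb_sum_mul_eq_zero_le hS (i := i.succ) (by simpa [w, sub_eq_zero] using hpq)
  have h2 : coeffProb S _ (fun c : Fin (min n (n - r + 1) + 1) → k => ∑ j, c j * w j ≠ 0 ∧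
      ¬ (Z ∩ affHyperplane (r := r) c).Nonempty) ≤ (d : ℝ) / S.card := by
    refine coeffProb_le_div hS 0 fun a T hT => ?_
    rcases T.eq_empty_or_nonempty with rfl | ⟨b, hb⟩
    · simp
    simp only [Fin.insertNth_zero'] at hT
    have hb' := (hT b hb).2.1
    rw [Ne, hw, Fin.tail_cons] at hb'
    classical
    -- A constant term `b` makes the hyperplane miss `Z` exactly when `g a` omits the value `-b`.
    rw [← Finset.card_image_of_injective T neg_injective]
    refine hd.card_le_of_forall_ne hZ hirr (g a) ?_ _ ?_
    · rintro ⟨e, he⟩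
      exact hb' ((he p hp).trans (he q hq).symm)
    · intro e he x hx hxe
      obtain ⟨b, hb, rfl⟩ := Finset.mem_image.mp he
      refine (hT b hb).2.2 ⟨x, hx, (hH _ _).mpr ?_⟩
      rw [Fin.tail_cons, hxe, Fin.cons_zero, add_neg_cancel]
  have h3 : (1 : ℝ) ≤ d := by exact_mod_cast hd.pos hZ hirr
  refine (coeffProb_le_add (A := fun c => ∑ j, c j * w j = 0)
    (B := fun c => ∑ j, c j * w j ≠ 0 ∧ ¬ (Z ∩ affHyperplane (r := r) c).Nonempty)
    fun c hc => ?_).trans ((add_le_add h1 h2).trans ?_)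
  · by_cases h0 : ∑ j, c j * w j = 0
    · exact .inl h0
    · refine .inr ⟨h0, hc.resolve_left fun hsub => h0 ((hw c).mpr ?_)⟩
      exact add_left_cancel (((hH c p).mp (hsub hp)).trans ((hH c q).mp (hsub hq)).symm)
  · rw [← add_div]
    gcongr
    linarith

end RandomHyperplanes

theorem lemma3 {k : Type*} [Field k] [IsAlgClosed k] (n r D : ℕ)
    (S : Finset k) (hS : S.Nonempty) (hS0 : (0 : k) ∉ S) :
    (∀ V : Set (ProjSpace k n), IsClosed V → zariskiDim V = ((r : ℤ) : WithTop ℤ) →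
      ProjHasDegree V D →
      1 - (D : ℝ) / (S.card : ℝ) ≤
        coeffProb S (n - r + 1) fun c =>
          zariskiDim (V ∩ projHyperplane (r := r) c) = (((r : ℤ) - 1 : ℤ) : WithTop ℤ)) ∧
    (∀ V : Set (AffSpace k n), IsClosed V → zariskiDim V = ((r : ℤ) : WithTop ℤ) →
      AffHasDegree V D →
      1 - 2 * (D : ℝ) / (S.card : ℝ) ≤
        coeffProb S (min n (n - r + 1) + 1) fun c =>
          zariskiDim (V ∩ affHyperplane (r := r) c) = (((r : ℤ) - 1 : ℤ) : WithTop ℤ)) := by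
  constructor
  · rintro V hV hdim ⟨C, δ, hC, hδ, rfl⟩
    have hr := zariskiDim_eq_natCast_iff.mp hdim
    have hcomp : ∀ Z ∈ C, Z ∈ componentsOf V := fun Z hZ => hC ▸ hZ
    rw [Nat.cast_sum]
    refine one_sub_sum_div_le_coeffProb hS
      (B := fun (Z : Set _) c => topologicalKrullDim Z = (r : WithBot ℕ∞) ∧
      Z ⊆ projHyperplane (r := r) c) (fun Z hZ => ?_) fun c hc => ?_
    · have hcl := isClosed_of_mem_componentsOf hV (hcomp Z hZ)
      have hpos : (1 : ℝ) ≤ δ Z := by exact_mod_cast (hδ Z hZ).pos hcl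
      -- Components of smaller dimension have an empty bad event, although their degrees count in
      -- `D`.
      by_cases hZr : topologicalKrullDim Z = (r : WithBot ℕ∞)
      · simp only [hZr, true_and]
        refine (coeffProb_subset_projHyperplane_le hS hcl (hcomp Z hZ).1.1 hZr.ge).trans ?_
        gcongr
      · simp only [hZr, false_and]
        simp only [coeffProb, Finset.filter_false, Finset.card_empty, Nat.cast_zero, zero_div]
        positivity
    · exact zariskiDim_inter_projHyperplane hV hr fun Z hZ hZr hsub =>
        hc Z (by rwa [← Finset.mem_coe, hC]) ⟨hZr, hsub⟩
  · rintro V hV hdim ⟨C, δ, hC, hδ, rfl⟩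
    have hr := zariskiDim_eq_natCast_iff.mp hdim
    have hcomp : ∀ Z ∈ C, Z ∈ componentsOf V := fun Z hZ => hC ▸ hZ
    rw [Nat.cast_sum, Finset.mul_sum]
    refine one_sub_sum_div_le_coeffProb hS
      (B := fun (Z : Set _) c => topologicalKrullDim Z = (r : WithBot ℕ∞) ∧
      (Z ⊆ affHyperplane (r := r) c ∨ (r ≠ 0 ∧ ¬ (Z ∩ affHyperplane (r := r) c).Nonempty)))
      (fun Z hZ => ?_) fun c hc => ?_
    · have hcl := isClosed_of_mem_componentsOf hV (hcomp Z hZ)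
      have hirr := (hcomp Z hZ).1.1
      have hpos : (1 : ℝ) ≤ δ Z := by exact_mod_cast (hδ Z hZ).pos hcl hirr
      by_cases hZr : topologicalKrullDim Z = (r : WithBot ℕ∞)
      · simp only [hZr, true_and]
        by_cases hr0 : r = 0
        · simp only [hr0, ne_eq, not_true_eq_false, false_and, or_false]
          refine (coeffProb_subset_affHyperplane_le hS hirr.nonempty).trans ?_
          gcongr
          linarith
        · simp only [hr0, ne_eq, not_false_eq_true, true_and]
          exact coeffProb_subset_or_disjoint_affHyperplane_le hr0 hS hcl hirr hZr.ge (hδ Z hZ)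
      · simp only [hZr, false_and]
        simp only [coeffProb, Finset.filter_false, Finset.card_empty, Nat.cast_zero, zero_div]
        positivity
    · refine zariskiDim_inter_affHyperplane hV hr fun Z hZ hZr => ?_
      have := hc Z (by rwa [← Finset.mem_coe, hC])
      simp only [hZr, true_and, not_or, not_and, not_not] at this
      exact this
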